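/- A fusion ring of finite rank with basis $(b_i)$ is given by fusion rules $b_ib_j=\sum_k N_{i,j}^k b_k$, $N_{i,j}^k\in\mathbb{Z}_{\ge 0}$, which are associative, have a neutral basis element $b_1$, and a duality $i\mapsto i^*$ with $N_{i,k}^1=N_{k,i}^1=\delta_{i^*,k}$ and $N_{i,j}^k=N_{i^*,k}^j=N_{k,j^*}^i$. If it is commutative, an eigentable of it is a table $(\lambda_{i,j})$ such that the fusion matrices $M_i=(N_{i,j}^k)_{k,j}$ are simultaneously diagonalized, in a suitable basis, to $\mathrm{diag}(\lambda_{i,j})_j$. A commutative fusion ring passes the Schur product criterion if for every eigentable $(\lambda_{i,j})$ of it, with its distinguished column numbered $1$ so that $\lambda_{i,1}=\max_j|\lambda_{i,j}|$ for all $i$, and for all columns $j_1,j_2,j_3$, the sum $\sum_i \lambda_{i,j_1}\lambda_{i,j_2}\lambda_{i,j_3}/\lambda_{i,1}$ is real and nonnegative. For an integer $q\ge 2$ let $T_q$ be the following square complex table, the generic character table of $\mathrm{PSL}(2,q)$ interpolated to all integers $q \ge 2$. Write $\zeta_n=\exp(2\pi i/n)$ and $z_n(m)=\zeta_n^{m}+\zeta_n^{-m}$.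 A row with a parameter $c$ (a column with a parameter $k$) stands for one row (column) for each value of the parameter. (i) $q$ even. Rows: one of degree $1$; degree $q-1$ with $1\le c\le \frac q2$; one of degree $q$; degree $q+1$ with $1\le c\le\frac{q-2}2$. Columns: two single columns, a block with $1\le k\le\frac{q-2}{2}$, and a block with $1\le k\le\frac q2$. Entries: $$\begin{array}{c|cccc} 1 & 1&1&1&1\\ q-1 & q-1&-1&0&-z_{q+1}(kc)\\ q & q&0&1&-1\\ q+1 & q+1&1&z_{q-1}(kc)&0 \end{array}$$ (ii) $q\equiv -1 \bmod 4$. Rows: one of degree $1$; degree $\frac{q-1}2$ with $c\in\{1,2\}$; degree $q-1$ with $1\le c\le \frac{q-3}4$; one of degree $q$; degree $q+1$ with $1\le c\le\frac{q-3}4$. Columns: one single column; $k\in\{1,2\}$; $1\le k\le\frac{q-3}{4}$; $1\le k\le\frac{q-3}4$; $k=\frac{q+1}4$. Entries: $$\begin{array}{c|ccccc} 1 & 1&1&1&1&1\\ \frac{q-1}2 & \frac{q-1}2&\frac{-1+i(-1)^{k+c}\sqrt q}{2}&0&(-1)^{k+1}&(-1)^{k+1}\\ q-1 & q-1&-1&0&-z_{q+1}(2kc)&-2(-1)^c\\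 q & q&0&1&-1&-1\\ q+1 & q+1&1&z_{q-1}(2kc)&0&0 \end{array}$$ (iii) $q\equiv 1 \bmod 4$. Rows: one of degree $1$; degree $\frac{q+1}2$ with $c\in\{1,2\}$; degree $q-1$ with $1\le c\le \frac{q-1}4$; one of degree $q$; degree $q+1$ with $1\le c\le\frac{q-5}4$. Columns: one single column; $k\in\{1,2\}$; $1\le k\le\frac{q-5}{4}$; $k=\frac{q-1}4$; $1\le k\le\frac{q-1}4$. Entries: $$\begin{array}{c|ccccc} 1 & 1&1&1&1&1\\ \frac{q+1}2 & \frac{q+1}2&\frac{1+(-1)^{k+c}\sqrt q}{2}&(-1)^{k}&(-1)^{k}&0\\ q-1 & q-1&-1&0&0&-z_{q+1}(2kc)\\ q & q&0&1&1&-1\\ q+1 & q+1&1&z_{q-1}(2kc)&2(-1)^c&0 \end{array}$$ **Proposition.** Let $q\ge 2$ be an integer. There is exactly one fusion ring $\mathcal{R}_q$ with basis indexed by the rows of $T_q$ that is commutative and has $T_q$ as an eigentable (the interpolated fusion ring). The first column of $T_q$ is its distinguished column, i.e. $(T_q)_{i,1}=\max_j|(T_q)_{i,j}|$ for all $i$;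 for all columns $j_1,j_2,j_3$ of $T_q$ the sum $$\sum_i\frac{(T_q)_{i,j_1}(T_q)_{i,j_2}(T_q)_{i,j_3}}{(T_q)_{i,1}}$$ is real and nonnegative; and $\mathcal{R}_q$ passes the Schur product criterion. -/

import Mathlib

open scoped ComplexOrder

/-- A fusion ring with basis `(b_i)`, `i : ι`, given by its fusion rules
`b_i b_j = ∑ k, N i j k • b_k` on the free `ℤ`-module on the basis. -/
@[ext]
structure FusionRing (ι : Type) [Fintype ι] [DecidableEq ι] where
  /-- The structure constants `N_{i,j}^k`. -/
  N : ι → ι → ι → ℕ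
  /-- The index of the neutral basis element. -/
  one : ι
  /-- The duality `i ↦ i^*`. -/
  dual : ι → ι
  /-- Associativity, `b_i (b_j b_k) = (b_i b_j) b_k`, compared at each `b_l`. -/
  assoc : ∀ i j k l, ∑ m, N j k m * N i m l = ∑ m, N i j m * N m k l
  one_mul : ∀ i k, N one i k = if k = i then 1 else 0
  mul_one : ∀ i k, N i one k = if k = i then 1 else 0
  dual_right : ∀ i k, N i k one = if k = dual i then 1 else 0
  dual_left : ∀ i k, N k i one = if k = dual i then 1 else 0
  frobenius_left : ∀ i j k, N i j k = N (dual i) k j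
  frobenius_right : ∀ i j k, N i j k = N k (dual j) i

namespace FusionRing

variable {ι : Type} [Fintype ι] [DecidableEq ι]

/-- The fusion ring is commutative: `b_i b_j = b_j b_i`. -/
def IsCommutative (R : FusionRing ι) : Prop := ∀ i j k, R.N i j k = R.N j i k

/-- The fusion matrix `M_i = (N_{i,j}^k)_{k,j}`: row `k`, column `j`. -/
def fusionMatrix (R : FusionRing ι) (i : ι) : Matrix ι ι ℂ :=
  Matrix.of fun k j => (R.N i j k : ℂ)

/-- `lam` is an eigentable of the commutative fusion ring `R`: in a suitable basis `(v j)` of the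
space on which the fusion matrices act, every `M_i` becomes the diagonal matrix `diag (lam i j)_j`.
The columns may be indexed by any type `κ` (necessarily of the same cardinality as `ι`). -/
def IsEigentable (R : FusionRing ι) {κ : Type} (lam : ι → κ → ℂ) : Prop :=
  R.IsCommutative ∧
    ∃ v : Module.Basis κ ℂ (ι → ℂ), ∀ i j, (R.fusionMatrix i).mulVec (v j) = lam i j • v j

end FusionRing

/-- The column `j₀` of a table is the distinguished (first) one:
`lam i j₀ = max_j |lam i j|` for every row `i`. -/
def IsMaxColumn {ι κ : Type} (lam : ι → κ → ℂ) (j₀ : κ) : Prop :=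
  ∀ i, lam i j₀ = (‖lam i j₀‖ : ℂ) ∧ ∀ j, ‖lam i j‖ ≤ ‖lam i j₀‖

/-- The commutative Schur product criterion. Here `0 ≤ z` for a complex number `z` means that
`z` is real and nonnegative. -/
def FusionRing.PassesSchurProductCriterion {ι : Type} [Fintype ι] [DecidableEq ι]
    (R : FusionRing ι) : Prop :=
  ∀ (κ : Type) (lam : ι → κ → ℂ) (j₀ : κ), R.IsEigentable lam → IsMaxColumn lam j₀ →
    ∀ j₁ j₂ j₃ : κ, (0 : ℂ) ≤ ∑ i, lam i j₁ * lam i j₂ * lam i j₃ / lam i j₀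

/-- A formal table: rows, columns, complex entries, and a first column. -/
structure FormalTable where
  Row : Type
  Col : Type
  rowFintype : Fintype Row
  rowDecidableEq : DecidableEq Row
  entry : Row → Col → ℂ
  firstCol : Col

attribute [instance] FormalTable.rowFintype FormalTable.rowDecidableEq

noncomputable section

/-- The root of unity `ζ_n = exp (2 π i / n)`. -/
def zetaRoot (n : ℕ) : ℂ := Complex.exp (2 * Real.pi * Complex.I / n)

/-- `ζ_n ^ m + ζ_n ^ (-m)`. -/
def zetaSum (n m : ℕ) : ℂ := zetaRoot n ^ m + (zetaRoot n ^ m)⁻¹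

/-- The parameter in `{1, …, n}` that an element of `Fin n` stands for. -/
def param {n : ℕ} (a : Fin n) : ℕ := a.val + 1

/-- Entries of the generic character table of `PSL(2,q)`, `q` even.
Row blocks: degree `1`; degree `q - 1` with `c ∈ {1, …, q/2}`; degree `q`;
degree `q + 1` with `c ∈ {1, …, (q-2)/2}`.
Column blocks, by class size: `1`; `q² - 1`; `q (q+1)` with `k ∈ {1, …, (q-2)/2}`;
`q (q-1)` with `k ∈ {1, …, q/2}`. -/
def entryEven (q : ℕ) :
    Unit ⊕ Fin (q / 2) ⊕ Unit ⊕ Fin ((q - 2) / 2) →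
    Unit ⊕ Unit ⊕ Fin ((q - 2) / 2) ⊕ Fin (q / 2) → ℂ
  -- degree 1
  | .inl _, _ => 1
  -- degree q - 1
  | .inr (.inl _), .inl _ => q - 1
  | .inr (.inl _), .inr (.inl _) => -1
  | .inr (.inl _), .inr (.inr (.inl _)) => 0
  | .inr (.inl c), .inr (.inr (.inr k)) => -zetaSum (q + 1) (param k * param c)
  -- degree q
  | .inr (.inr (.inl _)), .inl _ => q
  | .inr (.inr (.inl _)), .inr (.inl _) => 0
  | .inr (.inr (.inl _)), .inr (.inr (.inl _)) => 1
  | .inr (.inr (.inl _)), .inr (.inr (.inr _)) => -1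
  -- degree q + 1
  | .inr (.inr (.inr _)), .inl _ => q + 1
  | .inr (.inr (.inr _)), .inr (.inl _) => 1
  | .inr (.inr (.inr c)), .inr (.inr (.inl k)) => zetaSum (q - 1) (param k * param c)
  | .inr (.inr (.inr _)), .inr (.inr (.inr _)) => 0

/-- Entries of the generic character table of `PSL(2,q)`, `q ≡ -1 mod 4`.
Row blocks: degree `1`; degree `(q-1)/2` with `c ∈ {1, 2}`; degree `q - 1` with
`c ∈ {1, …, (q-3)/4}`; degree `q`; degree `q + 1` with `c ∈ {1, …, (q-3)/4}`.
Column blocks, by class size: `1`; `(q²-1)/2` with `k ∈ {1, 2}`; `q (q+1)` with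
`k ∈ {1, …, (q-3)/4}`; `q (q-1)` with `k ∈ {1, …, (q-3)/4}`; `q (q-1)/2` with `k = (q+1)/4`. -/
def entryThree (q : ℕ) :
    Unit ⊕ Fin 2 ⊕ Fin ((q - 3) / 4) ⊕ Unit ⊕ Fin ((q - 3) / 4) →
    Unit ⊕ Fin 2 ⊕ Fin ((q - 3) / 4) ⊕ Fin ((q - 3) / 4) ⊕ Unit → ℂ
  -- degree 1
  | .inl _, _ => 1
  -- degree (q - 1) / 2
  | .inr (.inl _), .inl _ => ((q : ℂ) - 1) / 2
  | .inr (.inl c), .inr (.inl k) =>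
      (-1 + Complex.I * (-1) ^ (param k + param c) * (Real.sqrt q : ℂ)) / 2
  | .inr (.inl _), .inr (.inr (.inl _)) => 0
  | .inr (.inl _), .inr (.inr (.inr (.inl k))) => (-1) ^ (param k + 1)
  | .inr (.inl _), .inr (.inr (.inr (.inr _))) => (-1) ^ ((q + 1) / 4 + 1)
  -- degree q - 1
  | .inr (.inr (.inl _)), .inl _ => q - 1
  | .inr (.inr (.inl _)), .inr (.inl _) => -1
  | .inr (.inr (.inl _)), .inr (.inr (.inl _)) => 0
  | .inr (.inr (.inl c)), .inr (.inr (.inr (.inl k))) =>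
      -zetaSum (q + 1) (2 * param k * param c)
  | .inr (.inr (.inl c)), .inr (.inr (.inr (.inr _))) => -2 * (-1) ^ param c
  -- degree q
  | .inr (.inr (.inr (.inl _))), .inl _ => q
  | .inr (.inr (.inr (.inl _))), .inr (.inl _) => 0
  | .inr (.inr (.inr (.inl _))), .inr (.inr (.inl _)) => 1
  | .inr (.inr (.inr (.inl _))), .inr (.inr (.inr (.inl _))) => -1
  | .inr (.inr (.inr (.inl _))), .inr (.inr (.inr (.inr _))) => -1
  -- degree q + 1
  | .inr (.inr (.inr (.inr _))), .inl _ => q + 1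
  | .inr (.inr (.inr (.inr _))), .inr (.inl _) => 1
  | .inr (.inr (.inr (.inr c))), .inr (.inr (.inl k)) =>
      zetaSum (q - 1) (2 * param k * param c)
  | .inr (.inr (.inr (.inr _))), .inr (.inr (.inr (.inl _))) => 0
  | .inr (.inr (.inr (.inr _))), .inr (.inr (.inr (.inr _))) => 0

/-- Entries of the generic character table of `PSL(2,q)`, `q ≡ 1 mod 4`.
Row blocks: degree `1`; degree `(q+1)/2` with `c ∈ {1, 2}`; degree `q - 1` with
`c ∈ {1, …, (q-1)/4}`; degree `q`; degree `q + 1` with `c ∈ {1, …, (q-5)/4}`.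
Column blocks, by class size: `1`; `(q²-1)/2` with `k ∈ {1, 2}`; `q (q+1)` with
`k ∈ {1, …, (q-5)/4}`; `q (q+1)/2` with `k = (q-1)/4`; `q (q-1)` with `k ∈ {1, …, (q-1)/4}`. -/
def entryOne (q : ℕ) :
    Unit ⊕ Fin 2 ⊕ Fin ((q - 1) / 4) ⊕ Unit ⊕ Fin ((q - 5) / 4) →
    Unit ⊕ Fin 2 ⊕ Fin ((q - 5) / 4) ⊕ Unit ⊕ Fin ((q - 1) / 4) → ℂ
  -- degree 1
  | .inl _, _ => 1
  -- degree (q + 1) / 2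
  | .inr (.inl _), .inl _ => ((q : ℂ) + 1) / 2
  | .inr (.inl c), .inr (.inl k) =>
      (1 + (-1) ^ (param k + param c) * (Real.sqrt q : ℂ)) / 2
  | .inr (.inl _), .inr (.inr (.inl k)) => (-1) ^ param k
  | .inr (.inl _), .inr (.inr (.inr (.inl _))) => (-1) ^ ((q - 1) / 4)
  | .inr (.inl _), .inr (.inr (.inr (.inr _))) => 0
  -- degree q - 1
  | .inr (.inr (.inl _)), .inl _ => q - 1
  | .inr (.inr (.inl _)), .inr (.inl _) => -1
  | .inr (.inr (.inl _)), .inr (.inr (.inl _)) => 0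
  | .inr (.inr (.inl _)), .inr (.inr (.inr (.inl _))) => 0
  | .inr (.inr (.inl c)), .inr (.inr (.inr (.inr k))) =>
      -zetaSum (q + 1) (2 * param k * param c)
  -- degree q
  | .inr (.inr (.inr (.inl _))), .inl _ => q
  | .inr (.inr (.inr (.inl _))), .inr (.inl _) => 0
  | .inr (.inr (.inr (.inl _))), .inr (.inr (.inl _)) => 1
  | .inr (.inr (.inr (.inl _))), .inr (.inr (.inr (.inl _))) => 1
  | .inr (.inr (.inr (.inl _))), .inr (.inr (.inr (.inr _))) => -1
  -- degree q + 1
  | .inr (.inr (.inr (.inr _))), .inl _ => q + 1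
  | .inr (.inr (.inr (.inr _))), .inr (.inl _) => 1
  | .inr (.inr (.inr (.inr c))), .inr (.inr (.inl k)) =>
      zetaSum (q - 1) (2 * param k * param c)
  | .inr (.inr (.inr (.inr c))), .inr (.inr (.inr (.inl _))) => 2 * (-1) ^ param c
  | .inr (.inr (.inr (.inr _))), .inr (.inr (.inr (.inr _))) => 0

/-- The generic character table of `PSL(2,q)`, `q` even, interpolated. -/
def tableEven (q : ℕ) : FormalTable where
  Row := Unit ⊕ Fin (q / 2) ⊕ Unit ⊕ Fin ((q - 2) / 2)
  Col := Unit ⊕ Unit ⊕ Fin ((q - 2) / 2) ⊕ Fin (q / 2)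
  rowFintype := inferInstance
  rowDecidableEq := inferInstance
  entry := entryEven q
  firstCol := .inl ()

/-- The generic character table of `PSL(2,q)`, `q ≡ -1 mod 4`, interpolated. -/
def tableThree (q : ℕ) : FormalTable where
  Row := Unit ⊕ Fin 2 ⊕ Fin ((q - 3) / 4) ⊕ Unit ⊕ Fin ((q - 3) / 4)
  Col := Unit ⊕ Fin 2 ⊕ Fin ((q - 3) / 4) ⊕ Fin ((q - 3) / 4) ⊕ Unit
  rowFintype := inferInstance
  rowDecidableEq := inferInstance
  entry := entryThree q
  firstCol := .inl ()

/-- The generic character table of `PSL(2,q)`, `q ≡ 1 mod 4`, interpolated. -/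
def tableOne (q : ℕ) : FormalTable where
  Row := Unit ⊕ Fin 2 ⊕ Fin ((q - 1) / 4) ⊕ Unit ⊕ Fin ((q - 5) / 4)
  Col := Unit ⊕ Fin 2 ⊕ Fin ((q - 5) / 4) ⊕ Unit ⊕ Fin ((q - 1) / 4)
  rowFintype := inferInstance
  rowDecidableEq := inferInstance
  entry := entryOne q
  firstCol := .inl ()

/-- The generic character table of `PSL(2,q)`, interpolated to every integer `q ≥ 2`. -/
def genericTable (q : ℕ) : FormalTable :=
  if q % 2 = 0 then tableEven q else if q % 4 = 3 then tableThree q else tableOne q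

end

/-- `R` is the interpolated fusion ring `R_q`: the fusion ring with basis indexed by the rows of
the generic character table whose eigentable is that table (the eigentable determines the fusion
rules). -/
def IsInterpolatedFusionRing (q : ℕ) (R : FusionRing (genericTable q).Row) : Prop :=
  R.IsEigentable (genericTable q).entry

/-! ### Eigentables of an arbitrary commutative fusion ring -/

namespace FusionRing

variable {ι : Type} [Fintype ι] [DecidableEq ι]

/-! Let a square table have rows that are orthogonal for positive column weights `w` and closed
under complex conjugation, one of them constantly `1`. It is the eigentable of a fusion ring once
all Verlinde sums `∑ l, w l * (lam i l * lam j l * lam k l)` are natural numbers, and orthogonality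
of the rows makes that ring unique (`VerlindeTable.fusionRing`, `VerlindeTable.eq_fusionRing`). A
positive column dominates all others by a Perron–Frobenius argument. All eigentables of a ring have
the same columns, so the Schur criterion concerns only the given table; if one of the three columns
is the distinguished one, the sum is an instance of column orthogonality. Two tasks remain:
integrality of triple sums over the columns, and nonnegativity of triple sums over the rows away
from the first column.

Put `g = gcd (2, q - 1)`, `M = (q - 1) / g`, `N = (q + 1) / g`. Every row is a combination `α P(a) +
β D(b) + γ U`, where `P` and `D` are the principal and the discrete series and `U` is `±ξ` on the
unipotent columns and zero elsewhere, with `ξ ^ 2 = η q`. The trivial and the Steinberg row are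
`(P(0) ∓ D(0)) / 2`, and the rows of half degree are halves of `P(M / 2)` or `D(N / 2)` corrected by
`U`. On the two tori the entries are cosines, and a sum of products of three cosines counts the sign
choices for which `a ± b ± c` is a multiple of the order. In the sum over the columns all other
dependence on `q` cancels, which leaves `tripleForm`. For three discrete series rows it is `g -
dvdCount`, a natural number because at most one sign choice qualifies.

The sums over the rows have the same shape and give `schurForm`. Its delicate cases are nonsplit
columns, where the count must be bounded in terms of `g`, and three unipotent columns, where the
bounds `q ≥ 2` and, for `g = 2`, `q ≥ 3` are sharp. Nowhere does `q` have to be a prime power. -/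

theorem fusionMatrix_mul (R : FusionRing ι) (i j : ι) :
    R.fusionMatrix i * R.fusionMatrix j = ∑ k, (R.N i j k : ℂ) • R.fusionMatrix k := by
  ext k l
  have h := R.assoc i j l k
  simp only [Matrix.mul_apply, Matrix.sum_apply, Matrix.smul_apply, fusionMatrix, Matrix.of_apply,
    smul_eq_mul]
  calc ∑ m, (R.N i m k : ℂ) * (R.N j l m : ℂ) = ((∑ m, R.N j l m * R.N i m k : ℕ) : ℂ) := by
        push_cast
        exact Finset.sum_congr rfl fun m _ => mul_comm _ _
    _ = _ := by rw [h]; push_cast; rfl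

theorem fusionMatrix_one (R : FusionRing ι) : R.fusionMatrix R.one = 1 := by
  ext k l
  simp [fusionMatrix, R.one_mul, Matrix.one_apply]

variable {R : FusionRing ι} {κ κ' : Type} {lam : ι → κ → ℂ} {lam' : ι → κ' → ℂ}

/-- The fusion matrices represent the ring, and `v l` is a common eigenvector, so its eigenvalues
form a character of the ring. -/
theorem IsEigentable.mul_apply (h : R.IsEigentable lam) (i j : ι) (l : κ) :
    lam i l * lam j l = ∑ k, (R.N i j k : ℂ) * lam k l := by
  obtain ⟨-, v, hv⟩ := h
  have h0 : v l ≠ 0 := v.ne_zero l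
  have h1 : (R.fusionMatrix i * R.fusionMatrix j).mulVec (v l) = (lam i l * lam j l) • v l := by
    rw [← Matrix.mulVec_mulVec, hv, Matrix.mulVec_smul, hv, smul_smul, mul_comm]
  rw [fusionMatrix_mul, Matrix.sum_mulVec] at h1
  simp only [Matrix.smul_mulVec, hv, smul_smul, ← Finset.sum_smul] at h1
  exact (smul_left_injective ℂ h0 h1).symm

theorem IsEigentable.one_apply (h : R.IsEigentable lam) (l : κ) : lam R.one l = 1 := by
  obtain ⟨-, v, hv⟩ := h
  have h1 := hv R.one l
  rw [fusionMatrix_one, Matrix.one_mulVec] at h1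
  have : (1 : ℂ) • v l = lam R.one l • v l := by rw [one_smul]; exact h1
  exact (smul_left_injective ℂ (v.ne_zero l) this).symm

/-- Two eigentables of a fusion ring have the same columns. -/
theorem IsEigentable.exists_column (h : R.IsEigentable lam) (h' : R.IsEigentable lam') (j : κ') :
    ∃ l : κ, ∀ i, lam' i j = lam i l := by
  obtain ⟨-, v, hv⟩ := h
  obtain ⟨-, v', hv'⟩ := h'
  -- Expand the eigenvector `v' j` in the basis `v`. Any coordinate `l` that does not vanish serves
  -- for all `i` at once: comparing the `l`-coordinates of `M_i (v' j)` identifies the two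
  -- eigenvalues.
  obtain ⟨l, hl⟩ : ∃ l, v.repr (v' j) l ≠ 0 := by
    by_contra! hc
    exact v'.ne_zero j (v.repr.map_eq_zero_iff.mp (Finsupp.ext hc))
  refine ⟨l, fun i => ?_⟩
  have key : ∀ x : ι → ℂ, v.repr ((R.fusionMatrix i).mulVec x) l = lam i l * v.repr x l := by
    intro x
    have : (Finsupp.lapply l ∘ₗ v.repr.toLinearMap ∘ₗ (R.fusionMatrix i).mulVecLin) =
        lam i l • (Finsupp.lapply l ∘ₗ v.repr.toLinearMap) := by
      refine v.ext fun m => ?_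
      by_cases hm : m = l
      · subst hm; simp [hv]
      · simp [hv, hm]
    simpa using congrArg (fun f => f x) this
  have h1 := key (v' j)
  rw [hv'] at h1
  simp only [map_smul, Finsupp.smul_apply, smul_eq_mul] at h1
  exact mul_right_cancel₀ hl h1

/-- A column with positive entries is the distinguished one. -/
theorem IsEigentable.isMaxColumn (h : R.IsEigentable lam) {j₀ : κ} (hpos : ∀ i, 0 < lam i j₀) :
    IsMaxColumn lam j₀ := by
  have hd : ∀ i, lam i j₀ = (‖lam i j₀‖ : ℂ) := fun i => (Complex.norm_of_nonneg' (hpos i).le).symm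
  have hd0 : ∀ i, 0 < ‖lam i j₀‖ := fun i => norm_pos_iff.mpr (hpos i).ne'
  refine fun i => ⟨hd i, fun l => ?_⟩
  have : Nonempty ι := ⟨i⟩
  -- Perron–Frobenius: apply the triangle inequality to `lam i l * lam j l` for the row `j` where
  -- the ratio to the positive column is largest. The maximal ratio `C` is at least `1`, its value
  -- at the neutral element, and so can be cancelled.
  obtain ⟨j, hj⟩ := Finite.exists_max fun j => ‖lam j l‖ / ‖lam j j₀‖
  set C := ‖lam j l‖ / ‖lam j j₀‖ with hC
  have hle : ∀ k, ‖lam k l‖ ≤ C * ‖lam k j₀‖ := fun k => (div_le_iff₀ (hd0 k)).mp (hj k)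
  have hC0 : 0 < C := by
    have h1 := hle R.one
    rw [h.one_apply, h.one_apply] at h1
    simp at h1
    linarith
  have hdd : ‖lam i j₀‖ * ‖lam j j₀‖ = ∑ k, (R.N i j k : ℝ) * ‖lam k j₀‖ := by
    have h1 := h.mul_apply i j j₀
    rw [hd i, hd j, Finset.sum_congr rfl fun k _ => by rw [hd k]] at h1
    exact_mod_cast h1
  have h2 : ‖lam i l‖ * (C * ‖lam j j₀‖) ≤ ‖lam i j₀‖ * (C * ‖lam j j₀‖) := by
    calc ‖lam i l‖ * (C * ‖lam j j₀‖) = ‖lam i l * lam j l‖ := by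
          rw [norm_mul, hC, div_mul_cancel₀ _ (hd0 j).ne']
      _ ≤ ∑ k, (R.N i j k : ℝ) * ‖lam k l‖ := by
          rw [h.mul_apply]
          refine (norm_sum_le _ _).trans (le_of_eq ?_)
          simp
      _ ≤ ∑ k, (R.N i j k : ℝ) * (C * ‖lam k j₀‖) := by
          gcongr with k; exact hle k
      _ = C * (‖lam i j₀‖ * ‖lam j j₀‖) := by
          rw [hdd, Finset.mul_sum]; exact Finset.sum_congr rfl fun k _ => by ring
      _ = _ := by ring
  exact le_of_mul_le_mul_right h2 (mul_pos hC0 (hd0 j))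

/-- The Schur product criterion needs to be checked on one eigentable only. -/
theorem IsEigentable.passesSchurProductCriterion (h : R.IsEigentable lam) {j₀ : κ}
    (hmax : IsMaxColumn lam j₀)
    (hs : ∀ j₁ j₂ j₃, (0 : ℂ) ≤ ∑ i, lam i j₁ * lam i j₂ * lam i j₃ / lam i j₀) :
    R.PassesSchurProductCriterion := by
  intro κ' lam' j₀' h' hmax' j₁ j₂ j₃
  obtain ⟨l₀, hl₀⟩ := h.exists_column h' j₀'
  obtain ⟨m₀, hm₀⟩ := h'.exists_column h j₀
  -- Each distinguished column occurs in the other table and is dominated there, so the two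
  -- coincide.
  have h0 : ∀ i, lam' i j₀' = lam i j₀ := by
    intro i
    have h1 := (hmax i).2 l₀
    have h2 := (hmax' i).2 m₀
    rw [← hl₀] at h1
    rw [← hm₀] at h2
    rw [(hmax i).1, (hmax' i).1, le_antisymm h1 h2]
  obtain ⟨l₁, hl₁⟩ := h.exists_column h' j₁
  obtain ⟨l₂, hl₂⟩ := h.exists_column h' j₂
  obtain ⟨l₃, hl₃⟩ := h.exists_column h' j₃
  have := hs l₁ l₂ l₃
  simpa only [hl₁, hl₂, hl₃, h0] using this

end FusionRing

/-! ### Fusion rings from the Verlinde formula -/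

/-- A square table with orthogonal rows, closed under complex conjugation of rows and of columns,
whose structure constants are natural numbers. -/
structure VerlindeTable {ι κ : Type} [Fintype ι] [DecidableEq ι] [Fintype κ] [DecidableEq κ]
    (lam : ι → κ → ℂ) (j₀ : κ) where
  w : κ → ℂ
  one : ι
  dual : ι → ι
  dualCol : κ → κ
  card_eq : Fintype.card ι = Fintype.card κ
  w_pos : ∀ l, 0 < w l
  one_apply : ∀ l, lam one l = 1
  dual_apply : ∀ i l, lam (dual i) l = star (lam i l)
  dualCol_apply : ∀ i l, lam i (dualCol l) = star (lam i l)
  orth : ∀ i j, ∑ l, w l * (lam i l * lam j l) = if j = dual i then 1 else 0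
  exists_nat : ∀ i j k, ∃ n : ℕ, ∑ l, w l * (lam i l * lam j l * lam k l) = n
  pos : ∀ i, 0 < lam i j₀

namespace VerlindeTable

variable {ι κ : Type} [Fintype ι] [DecidableEq ι] [Fintype κ] [DecidableEq κ]
  {lam : ι → κ → ℂ} {j₀ : κ} (V : VerlindeTable lam j₀)

include V

/-- The bilinear form in `orth` is symmetric, so `j = dual i` and `i = dual j` are equivalent. -/
theorem dual_involutive : Function.Involutive V.dual := by
  intro i
  have h1 := V.orth i (V.dual i)
  have h2 := V.orth (V.dual i) i
  rw [if_pos rfl] at h1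
  simp only [mul_comm (lam (V.dual i) _), h1] at h2
  by_contra hne
  rw [if_neg (Ne.symm hne)] at h2
  exact one_ne_zero h2

theorem dual_dual (i : ι) : V.dual (V.dual i) = i := V.dual_involutive i

theorem eq_dual_comm {i j : ι} : i = V.dual j ↔ j = V.dual i :=
  ⟨fun h => by rw [h, V.dual_dual], fun h => by rw [h, V.dual_dual]⟩

theorem orth_dual (i j : ι) :
    ∑ l, V.w l * (lam i l * lam (V.dual j) l) = if i = j then 1 else 0 := by
  rw [V.orth]
  refine if_congr ?_ rfl rfl
  rw [V.eq_dual_comm, V.dual_dual]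

theorem row_injective {i j : ι} (h : ∀ l, lam i l = lam j l) : i = j := by
  have h1 := V.orth_dual i i
  have h2 := V.orth_dual j i
  simp only [h, h2] at h1
  by_contra hne
  simp [Ne.symm hne] at h1

theorem dual_one : V.dual V.one = V.one :=
  V.row_injective fun l => by simp [V.dual_apply, V.one_apply]

/-- Row orthogonality says that the table has a right inverse; since it is square, this is also a
left inverse. -/
theorem column_orth (l m : κ) :
    ∑ i, lam i l * (lam (V.dual i) m * V.w m) = if l = m then 1 else 0 := by
  have h : Matrix.of lam * (Matrix.of fun l j => lam (V.dual j) l * V.w l) = 1 := by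
    ext i j
    rw [Matrix.one_apply, ← V.orth_dual]
    simp only [Matrix.mul_apply, Matrix.of_apply]
    exact Finset.sum_congr rfl fun l _ => by ring
  have h' := (Matrix.mul_eq_one_comm_of_card_eq _ _ _ V.card_eq).mp h
  have h2 := congrFun (congrFun h' m) l
  rw [Matrix.one_apply] at h2
  simp only [Matrix.mul_apply, Matrix.of_apply] at h2
  simp only [eq_comm (a := l), ← h2]
  exact Finset.sum_congr rfl fun l _ => by ring

/-- The structure constants, given by the Verlinde formula. -/
noncomputable def coeff (i j k : ι) : ℕ := (V.exists_nat i j (V.dual k)).choose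

theorem coeff_eq (i j k : ι) :
    (V.coeff i j k : ℂ) = ∑ l, V.w l * (lam i l * lam j l * lam (V.dual k) l) :=
  (V.exists_nat i j (V.dual k)).choose_spec.symm

theorem mul_eq_sum_coeff (i j : ι) (l : κ) :
    lam i l * lam j l = ∑ k, (V.coeff i j k : ℂ) * lam k l := by
  simp only [V.coeff_eq, Finset.sum_mul]
  rw [Finset.sum_comm]
  have : ∀ m, ∑ k, V.w m * (lam i m * lam j m * lam (V.dual k) m) * lam k l =
      lam i m * lam j m * if l = m then 1 else 0 := by
    intro m
    rw [← V.column_orth, Finset.mul_sum]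
    exact Finset.sum_congr rfl fun k _ => by ring
  simp [this]

/-- Pairing an expansion with the dual row of `k` isolates the coefficient `c k`. -/
theorem coeff_unique {c : ι → ℂ} {i j : ι} (h : ∀ l, lam i l * lam j l = ∑ k, c k * lam k l)
    (k : ι) : c k = V.coeff i j k := by
  rw [V.coeff_eq]
  simp only [h, Finset.sum_mul, Finset.mul_sum]
  rw [Finset.sum_comm]
  have : ∀ m, ∑ l, V.w l * (c m * lam m l * lam (V.dual k) l) = c m * if m = k then 1 else 0 := by
    intro m
    rw [← V.orth_dual, Finset.mul_sum]
    exact Finset.sum_congr rfl fun l _ => by ring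
  simp [this]

/-- The right side is symmetric in `i`, `j`, `k`; associativity follows from this and commutativity.
-/
theorem sum_coeff_mul_coeff (i j k l : ι) : ((∑ m, V.coeff j k m * V.coeff i m l : ℕ) : ℂ) =
    ∑ x, V.w x * (lam i x * lam j x * lam k x * lam (V.dual l) x) := by
  push_cast
  simp only [V.coeff_eq i, Finset.mul_sum]
  rw [Finset.sum_comm]
  refine Finset.sum_congr rfl fun x _ => ?_
  rw [mul_assoc (lam i x), V.mul_eq_sum_coeff j k, Finset.mul_sum, Finset.sum_mul, Finset.mul_sum]
  exact Finset.sum_congr rfl fun m _ => by ring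

theorem coeff_comm (i j k : ι) : V.coeff i j k = V.coeff j i k := by
  have : (V.coeff i j k : ℂ) = V.coeff j i k := by
    simp only [V.coeff_eq, mul_comm (lam i _)]
  exact_mod_cast this

/-- The fusion ring with the given eigentable. -/
noncomputable def fusionRing : FusionRing ι where
  N := V.coeff
  one := V.one
  dual := V.dual
  assoc i j k l := by
    have h : ((∑ m, V.coeff j k m * V.coeff i m l : ℕ) : ℂ) =
        ((∑ m, V.coeff i j m * V.coeff m k l : ℕ) : ℂ) := by
      simp only [V.coeff_comm _ k]
      rw [sum_coeff_mul_coeff, sum_coeff_mul_coeff]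
      exact Finset.sum_congr rfl fun x _ => by ring
    exact_mod_cast h
  one_mul i k := by
    have h : (V.coeff V.one i k : ℂ) = if i = k then 1 else 0 := by
      rw [V.coeff_eq, ← V.orth_dual]
      simp [V.one_apply]
    simp only [eq_comm (a := i)] at h
    exact_mod_cast h
  mul_one i k := by
    have h : (V.coeff i V.one k : ℂ) = if i = k then 1 else 0 := by
      rw [V.coeff_eq, ← V.orth_dual]
      simp [V.one_apply]
    simp only [eq_comm (a := i)] at h
    exact_mod_cast h
  dual_right i k := by
    have h : (V.coeff i k V.one : ℂ) = if k = V.dual i then 1 else 0 := by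
      rw [V.coeff_eq, ← V.orth, V.dual_one]
      simp [V.one_apply]
    exact_mod_cast h
  dual_left i k := by
    have h : (V.coeff k i V.one : ℂ) = if k = V.dual i then 1 else 0 := by
      rw [V.coeff_comm, V.coeff_eq, ← V.orth, V.dual_one]
      simp [V.one_apply]
    exact_mod_cast h
  frobenius_left i j k := by
    have h : (V.coeff i j k : ℂ) = V.coeff (V.dual i) k j := by
      -- A natural number is its own conjugate, while conjugating the Verlinde sum replaces every
      -- row in it by its dual.
      rw [← Complex.conj_natCast (V.coeff (V.dual i) k j), V.coeff_eq, V.coeff_eq, map_sum]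
      refine Finset.sum_congr rfl fun l _ => ?_
      have hw : (starRingEnd ℂ) (V.w l) = V.w l :=
        Complex.conj_eq_iff_im.mpr (Complex.pos_iff.mp (V.w_pos l)).2.symm
      simp only [map_mul, hw, starRingEnd_apply, ← V.dual_apply, V.dual_dual]
      ring
    exact_mod_cast h
  frobenius_right i j k := by
    have h : (V.coeff i j k : ℂ) = V.coeff k (V.dual j) i := by
      rw [← Complex.conj_natCast (V.coeff k (V.dual j) i), V.coeff_eq, V.coeff_eq, map_sum]
      refine Finset.sum_congr rfl fun l _ => ?_
      have hw : (starRingEnd ℂ) (V.w l) = V.w l :=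
        Complex.conj_eq_iff_im.mpr (Complex.pos_iff.mp (V.w_pos l)).2.symm
      simp only [map_mul, hw, starRingEnd_apply, ← V.dual_apply, V.dual_dual]
      ring
    exact_mod_cast h

/-- The eigenvector for column `l` is `k ↦ lam (dual k) l * w l`. These vectors form a basis because
the table is invertible, and they are eigenvectors because the product of rows `i` and `dual k`
expands in rows, with structure constants symmetric up to duality. -/
theorem isEigentable_fusionRing : V.fusionRing.IsEigentable lam := by
  refine ⟨V.coeff_comm, ?_⟩
  let A : Matrix ι κ ℂ := Matrix.of fun i l => lam (V.dual i) l * V.w l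
  let B : Matrix κ ι ℂ := Matrix.of fun l i => lam i l
  have hBA : B * A = 1 := by
    ext l m
    simpa [A, B, Matrix.mul_apply, Matrix.one_apply] using V.column_orth l m
  have hAB : A * B = 1 := (Matrix.mul_eq_one_comm_of_card_eq _ _ _ V.card_eq.symm).mp hBA
  let e : (ι → ℂ) ≃ₗ[ℂ] (κ → ℂ) :=
    LinearEquiv.ofLinearMap B.mulVecLin A.mulVecLin
      (by rw [← Matrix.mulVecLin_mul, hBA, Matrix.mulVecLin_one])
      (by rw [← Matrix.mulVecLin_mul, hAB, Matrix.mulVecLin_one])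
  refine ⟨Module.Basis.ofEquivFun e, fun i l => ?_⟩
  have hv : Module.Basis.ofEquivFun e l = fun k => lam (V.dual k) l * V.w l := by
    rw [Module.Basis.coe_ofEquivFun]
    ext k
    simp [e, A]
  rw [hv]
  ext k
  have h := V.mul_eq_sum_coeff i (V.dual k) l
  simp only [FusionRing.fusionMatrix, Matrix.mulVec, dotProduct, Matrix.of_apply, Pi.smul_apply,
    smul_eq_mul, fusionRing]
  rw [← mul_assoc, h, Finset.sum_mul, ← Equiv.sum_comp (Function.Involutive.toPerm _ V.dual_involutive)]
  refine Finset.sum_congr rfl fun m _ => ?_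
  have h2 : V.coeff i (V.dual m) k = V.coeff i (V.dual k) m := by
    have h : (V.coeff i (V.dual m) k : ℂ) = V.coeff i (V.dual k) m := by
      rw [V.coeff_eq, V.coeff_eq]
      exact Finset.sum_congr rfl fun x _ => by ring
    exact_mod_cast h
  simp only [Function.Involutive.coe_toPerm, V.dual_dual, h2]
  ring

/-- Each column is a character of `R`, which fixes the structure constants; the neutral element is
the row of ones, and the dual of `i` is recognised by its product with `i` containing the neutral
element. -/
theorem eq_fusionRing {R : FusionRing ι} (h : R.IsEigentable lam) : R = V.fusionRing := by
  have hN : R.N = V.coeff := by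
    ext i j k
    have := V.coeff_unique (fun l => h.mul_apply i j l) k
    exact_mod_cast this
  have hone : R.one = V.one := V.row_injective fun l => by rw [h.one_apply, V.one_apply]
  refine FusionRing.ext hN hone ?_
  ext i
  have h1 := R.dual_right i (R.dual i)
  have h2 := V.fusionRing.dual_right i (R.dual i)
  rw [if_pos rfl, hN, hone] at h1
  by_contra hne
  rw [if_neg hne] at h2
  exact one_ne_zero (h1.symm.trans h2)

/-- By column orthogonality against the conjugate of column `m`, the sum is zero or the inverse of a
positive weight. -/
theorem sum_mul_column_nonneg (l m : κ) : 0 ≤ ∑ i, lam i l * lam i m := by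
  have h := V.column_orth l (V.dualCol m)
  have hw := V.w_pos (V.dualCol m)
  have h1 : (∑ i, lam i l * lam i m) * V.w (V.dualCol m) = if l = V.dualCol m then 1 else 0 := by
    rw [← h, Finset.sum_mul]
    exact Finset.sum_congr rfl fun i _ => by rw [V.dual_apply, V.dualCol_apply, star_star]; ring
  rw [eq_div_of_mul_eq hw.ne' h1]
  have hw' : 0 ≤ (V.w (V.dualCol m))⁻¹ := (inv_pos_of_pos hw).le
  split_ifs <;> simp [hw']

/-- The conclusions for the fusion ring of a Verlinde table; the sums of the Schur product
criterion have to be examined away from the distinguished column only. -/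
theorem conclusions (hs : ∀ j₁ j₂ j₃, j₁ ≠ j₀ → j₂ ≠ j₀ → j₃ ≠ j₀ →
      (0 : ℂ) ≤ ∑ i, lam i j₁ * lam i j₂ * lam i j₃ / lam i j₀) :
    (∃! R : FusionRing ι, R.IsEigentable lam) ∧ IsMaxColumn lam j₀ ∧
    (∀ j₁ j₂ j₃, (0 : ℂ) ≤ ∑ i, lam i j₁ * lam i j₂ * lam i j₃ / lam i j₀) ∧
    (∀ R : FusionRing ι, R.IsEigentable lam → R.PassesSchurProductCriterion) := by
  have hne := fun i => (V.pos i).ne'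
  have hs' : ∀ j₁ j₂ j₃, (0 : ℂ) ≤ ∑ i, lam i j₁ * lam i j₂ * lam i j₃ / lam i j₀ := by
    intro j₁ j₂ j₃
    by_cases h1 : j₁ = j₀
    · subst h1
      refine (V.sum_mul_column_nonneg j₂ j₃).trans_eq (Finset.sum_congr rfl fun i _ => ?_)
      field_simp [hne i]
    by_cases h2 : j₂ = j₀
    · subst h2
      refine (V.sum_mul_column_nonneg j₁ j₃).trans_eq (Finset.sum_congr rfl fun i _ => ?_)
      field_simp [hne i]
    by_cases h3 : j₃ = j₀
    · subst h3
      refine (V.sum_mul_column_nonneg j₁ j₂).trans_eq (Finset.sum_congr rfl fun i _ => ?_)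
      field_simp [hne i]
    exact hs _ _ _ h1 h2 h3
  have hmax := V.isEigentable_fusionRing.isMaxColumn V.pos
  exact ⟨⟨V.fusionRing, V.isEigentable_fusionRing, fun R h => V.eq_fusionRing h⟩, hmax, hs',
    fun R h => h.passesSchurProductCriterion hmax hs'⟩

end VerlindeTable

/-! ### Cosine sums over half a period -/

/-- `ζ_n ^ x + ζ_n ^ (-x)` for an integer exponent `x`. -/
noncomputable def zetaTrace (n : ℕ) (x : ℤ) : ℂ := zetaRoot n ^ x + (zetaRoot n ^ x)⁻¹

theorem zetaRoot_ne_zero (n : ℕ) : zetaRoot n ≠ 0 := Complex.exp_ne_zero _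

theorem isPrimitiveRoot_zetaRoot {n : ℕ} (hn : n ≠ 0) : IsPrimitiveRoot (zetaRoot n) n :=
  Complex.isPrimitiveRoot_exp n hn

theorem zetaRoot_mul_pow (m n : ℕ) (hm : m ≠ 0) : zetaRoot (m * n) ^ m = zetaRoot n := by
  rw [zetaRoot, ← Complex.exp_nat_mul, zetaRoot]
  congr 1
  have : (m : ℂ) ≠ 0 := by exact_mod_cast hm
  push_cast
  rcases eq_or_ne n 0 with rfl | hn
  · simp
  · have : (n : ℂ) ≠ 0 := by exact_mod_cast hn
    field_simp

theorem star_zetaRoot (n : ℕ) : star (zetaRoot n) = (zetaRoot n)⁻¹ := by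
  rw [zetaRoot, ← Complex.exp_neg, ← starRingEnd_apply, ← Complex.exp_conj]
  congr 1
  simp [Complex.conj_ofNat]
  ring

theorem zetaSum_eq (n m : ℕ) : zetaSum n m = zetaTrace n m := by
  simp [zetaSum, zetaTrace]

theorem zetaSum_two_mul (n m : ℕ) : zetaSum (2 * n) (2 * m) = zetaTrace n m := by
  rw [zetaSum, pow_mul, zetaRoot_mul_pow 2 n two_ne_zero]
  simp [zetaTrace]

theorem star_zetaTrace (n : ℕ) (x : ℤ) : star (zetaTrace n x) = zetaTrace n x := by
  simp only [zetaTrace, star_add, star_inv₀, star_zpow₀, star_zetaRoot, inv_zpow, inv_inv]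
  ring

theorem zetaTrace_zero (n : ℕ) : zetaTrace n 0 = 2 := by
  simp [zetaTrace]; norm_num

theorem zetaTrace_neg (n : ℕ) (x : ℤ) : zetaTrace n (-x) = zetaTrace n x := by
  simp only [zetaTrace, zpow_neg, inv_inv]; ring

theorem zetaTrace_mul (n : ℕ) (x y : ℤ) :
    zetaTrace n x * zetaTrace n y = zetaTrace n (x + y) + zetaTrace n (x - y) := by
  have h := zetaRoot_ne_zero n
  have hx := zpow_ne_zero x h
  have hy := zpow_ne_zero y h
  simp only [zetaTrace, zpow_add₀ h, zpow_sub₀ h]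
  field_simp
  ring

/-- The power `ζ_n ^ (n / 2)` is `-1`. This evaluates the cosines at the involution of a torus and
at its quadratic character. -/
theorem zetaTrace_mul_half {n r : ℕ} (hr : r ≠ 0) (hn : n = 2 * r) (k : ℕ) :
    zetaTrace n (k * r) = 2 * (-1) ^ k := by
  have h : zetaRoot n ^ r = -1 := by
    rw [hn, mul_comm, zetaRoot_mul_pow _ _ hr, zetaRoot]
    push_cast
    rw [show 2 * (Real.pi : ℂ) * Complex.I / 2 = Real.pi * Complex.I by ring, Complex.exp_pi_mul_I]
  have h2 : zetaRoot n ^ ((k : ℤ) * r) = (-1) ^ k := by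
    rw [mul_comm, zpow_mul, zpow_natCast, zpow_natCast, h]
  rw [zetaTrace, h2, ← inv_pow]
  norm_num
  ring

/-- The indicator function of the multiples of `n`. -/
def dvdInd (n : ℕ) (x : ℤ) : ℕ := if (n : ℤ) ∣ x then 1 else 0

theorem sum_zetaTrace {n : ℕ} (hn : n ≠ 0) (a : ℤ) :
    ∑ k ∈ Finset.range n, zetaTrace n (k * a) = 2 * n * dvdInd n a := by
  have hp := isPrimitiveRoot_zetaRoot hn
  have key : ∀ b : ℤ, ∑ k ∈ Finset.range n, (zetaRoot n ^ b) ^ k = n * dvdInd n b := by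
    intro b
    by_cases hb : (n : ℤ) ∣ b
    · rw [(hp.zpow_eq_one_iff_dvd b).mpr hb]
      simp [dvdInd, hb]
    · have hne : zetaRoot n ^ b ≠ 1 := fun h => hb ((hp.zpow_eq_one_iff_dvd b).mp h)
      rw [geom_sum_eq hne, ← zpow_natCast, ← zpow_mul, mul_comm, zpow_mul, zpow_natCast,
        hp.pow_eq_one]
      simp [dvdInd, hb]
  have h1 := key a
  have h2 := key (-a)
  have h3 : dvdInd n (-a) = dvdInd n a := by simp [dvdInd]
  rw [h3] at h2
  calc _ = ∑ k ∈ Finset.range n, ((zetaRoot n ^ a) ^ k + (zetaRoot n ^ (-a)) ^ k) := by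
        refine Finset.sum_congr rfl fun k _ => ?_
        rw [zetaTrace, mul_comm, zpow_mul, zpow_natCast, zpow_neg, inv_pow]
    _ = _ := by rw [Finset.sum_add_distrib, h1, h2]; ring

/-- The sum of `f` over `0 < k ≤ n / 2`, where a term at `k = n / 2` has weight `1 / 2`. -/
noncomputable def halfSum (n : ℕ) (f : ℕ → ℂ) : ℂ :=
  ∑ k ∈ Finset.range ((n - 1) / 2), f (k + 1) + if Even n then f (n / 2) / 2 else 0

theorem sum_fin_param (n : ℕ) (f : ℕ → ℂ) :
    ∑ k : Fin n, f (param k) = ∑ k ∈ Finset.range n, f (k + 1) :=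
  Fin.sum_univ_eq_sum_range (fun k => f (k + 1)) n

theorem sum_param_of_odd {m n : ℕ} (h : n = 2 * m + 1) (f : ℕ → ℂ) :
    ∑ k : Fin m, f (param k) = halfSum n f := by
  have h1 : (n - 1) / 2 = m := by omega
  have h2 : ¬ Even n := by rw [Nat.not_even_iff]; omega
  rw [sum_fin_param, halfSum, h1, if_neg h2, add_zero]

theorem sum_param_of_even {m n : ℕ} (h : n = 2 * m + 2) (f : ℕ → ℂ) :
    ∑ k : Fin m, f (param k) + f (m + 1) / 2 = halfSum n f := by
  have h1 : (n - 1) / 2 = m := by omega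
  have h2 : Even n := by rw [Nat.even_iff]; omega
  have h3 : n / 2 = m + 1 := by omega
  rw [sum_fin_param, halfSum, h1, if_pos h2, h3]

theorem halfSum_add (n : ℕ) (f f' : ℕ → ℂ) :
    halfSum n (fun k => f k + f' k) = halfSum n f + halfSum n f' := by
  simp only [halfSum, Finset.sum_add_distrib]
  split_ifs <;> ring

theorem halfSum_const_mul (n : ℕ) (c : ℂ) (f : ℕ → ℂ) :
    halfSum n (fun k => c * f k) = c * halfSum n f := by
  simp only [halfSum, ← Finset.mul_sum]
  split_ifs <;> ring

/-- The terms at `k` and `n - k` agree, so a full period is twice the half sum plus the term `2` at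
`k = 0`. For even `n` the midpoint is its own mirror image, hence its weight `1 / 2`. -/
theorem halfSum_zetaTrace {n : ℕ} (hn : n ≠ 0) (a : ℤ) :
    halfSum n (fun k => zetaTrace n (k * a)) = n * dvdInd n a - 1 := by
  have h := sum_zetaTrace hn a
  have hsymm : ∀ k ≤ n, zetaTrace n ((n - k : ℕ) * a) = zetaTrace n (k * a) := by
    intro k hk
    rw [← zetaTrace_neg n (k * a), zetaTrace, zetaTrace]
    have : zetaRoot n ^ (((n - k : ℕ) : ℤ) * a) = zetaRoot n ^ (-(k * a)) := by
      rw [Nat.cast_sub hk, sub_mul, sub_eq_add_neg, zpow_add₀ (zetaRoot_ne_zero n), zpow_mul,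
        zpow_natCast, (isPrimitiveRoot_zetaRoot hn).pow_eq_one, one_zpow, one_mul]
    rw [this]
  obtain ⟨m, hm | hm⟩ : ∃ m, n = 2 * m + 1 ∨ n = 2 * m + 2 := ⟨(n - 1) / 2, by omega⟩
  · rw [← sum_param_of_odd hm, sum_fin_param m fun k => zetaTrace n (k * a)]
    have h1 : ∑ k ∈ Finset.range n, zetaTrace n (k * a) = ∑ k ∈ Finset.range m,
        zetaTrace n ((m + 1 + k : ℕ) * a) + ∑ k ∈ Finset.range m, zetaTrace n ((k + 1 : ℕ) * a) +
          2 := by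
      rw [show n = (m + 1) + m by omega, Finset.sum_range_add, Finset.sum_range_succ']
      simp [zetaTrace_zero]
      ring
    have h2 : ∑ k ∈ Finset.range m, zetaTrace n ((m + 1 + k : ℕ) * a) =
        ∑ k ∈ Finset.range m, zetaTrace n ((k + 1 : ℕ) * a) := by
      rw [← Finset.sum_range_reflect]
      refine Finset.sum_congr rfl fun k hk => ?_
      have := Finset.mem_range.mp hk
      rw [← hsymm (k + 1) (by omega)]
      congr 3
      omega
    rw [h1, h2] at h
    linear_combination h / 2
  · rw [← sum_param_of_even hm, sum_fin_param m fun k => zetaTrace n (k * a)]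
    have h1 : ∑ k ∈ Finset.range n, zetaTrace n (k * a) = ∑ k ∈ Finset.range m,
        zetaTrace n ((m + 2 + k : ℕ) * a) + zetaTrace n ((m + 1 : ℕ) * a) +
          ∑ k ∈ Finset.range m, zetaTrace n ((k + 1 : ℕ) * a) + 2 := by
      rw [show n = (m + 2) + m by omega, Finset.sum_range_add, Finset.sum_range_succ,
        Finset.sum_range_succ']
      simp [zetaTrace_zero]
      ring
    have h2 : ∑ k ∈ Finset.range m, zetaTrace n ((m + 2 + k : ℕ) * a) =
        ∑ k ∈ Finset.range m, zetaTrace n ((k + 1 : ℕ) * a) := by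
      rw [← Finset.sum_range_reflect]
      refine Finset.sum_congr rfl fun k hk => ?_
      have := Finset.mem_range.mp hk
      rw [← hsymm (k + 1) (by omega)]
      congr 3
      omega
    rw [h1, h2] at h
    linear_combination h / 2

/-! ### Counting the multiples of `n` among `a ± b ± c` -/

/-- The number of multiples of `n` among `a ± b ± c`. -/
def dvdCount (n : ℕ) (a b c : ℤ) : ℕ :=
  dvdInd n (a + b + c) + dvdInd n (a + b - c) + dvdInd n (a - b + c) + dvdInd n (a - b - c)

theorem halfSum_zetaTrace_mul {n : ℕ} (hn : n ≠ 0) (t : ℂ) (a b c : ℤ) :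
    halfSum n (fun k => t * (zetaTrace n (k * a) * zetaTrace n (k * b) * zetaTrace n (k * c))) =
      t * (n * dvdCount n a b c - 4) := by
  have h : ∀ k : ℕ, zetaTrace n (k * a) * zetaTrace n (k * b) * zetaTrace n (k * c) =
      (zetaTrace n (k * (a + b + c)) + zetaTrace n (k * (a + b - c))) +
        (zetaTrace n (k * (a - b + c)) + zetaTrace n (k * (a - b - c))) := by
    intro k
    simp only [zetaTrace_mul, add_mul]
    congr 3 <;> ring_nf
  simp only [halfSum_const_mul, h, halfSum_add, halfSum_zetaTrace hn, dvdCount]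
  push_cast
  ring

theorem dvdInd_of_lt {n : ℕ} {x : ℤ} (h : x < 2 * n) (h' : -(2 * n) < x) :
    dvdInd n x = if x = 0 ∨ x = n ∨ x = -n then 1 else 0 := by
  rw [dvdInd]
  refine if_congr ⟨?_, ?_⟩ rfl rfl
  · rintro ⟨y, rfl⟩
    have h1 : y < 2 := by nlinarith
    have h2 : -2 < y := by nlinarith
    interval_cases y <;> simp
  · rintro (rfl | rfl | rfl) <;> simp

/-- All four signed sums lie strictly between `-2 * n` and `2 * n`, so divisibility becomes a few
linear equations that `omega` can handle. -/
theorem dvdCount_of_le {n : ℕ} {a b c : ℤ} (hn : n ≠ 0) (ha : 0 ≤ a) (ha' : 2 * a ≤ n) (hb : 0 ≤ b)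
    (hb' : 2 * b ≤ n) (hc : 0 ≤ c) (hc' : 2 * c ≤ n) : dvdCount n a b c =
      (if a + b + c = 0 ∨ a + b + c = n then 1 else 0) + (if a + b = c ∨ a + b - c = n then 1 else 0)
      + (if a + c = b ∨ a + c - b = n then 1 else 0)
      + (if b + c = a ∨ b + c - a = n then 1 else 0) := by
  rw [dvdCount, dvdInd_of_lt (by omega) (by omega), dvdInd_of_lt (by omega) (by omega),
    dvdInd_of_lt (by omega) (by omega), dvdInd_of_lt (by omega) (by omega)]
  congr 1
  · congr 1
    · congr 1 <;> exact if_congr (by omega) rfl rfl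
    · exact if_congr (by omega) rfl rfl
  · exact if_congr (by omega) rfl rfl

theorem dvdCount_zero_zero_zero {n : ℕ} : dvdCount n 0 0 0 = 4 := by simp [dvdCount, dvdInd]

theorem dvdCount_zero_zero {n : ℕ} {a : ℤ} (ha : 0 < a) (ha' : 2 * a ≤ n) :
    dvdCount n 0 0 a = 0 := by
  rw [dvdCount_of_le (by omega) (by omega) (by omega) (by omega) (by omega) (by omega) ha']
  split_ifs <;> omega

theorem dvdCount_zero {n : ℕ} {a b : ℤ} (ha : 0 < a) (ha' : 2 * a < n) (hb : 0 < b)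
    (hb' : 2 * b < n) : dvdCount n 0 a b = if a = b then 2 else 0 := by
  rw [dvdCount_of_le (by omega) (by omega) (by omega) (by omega) (by omega) (by omega) (by omega)]
  split_ifs <;> omega

/-- Two of the signed sums being multiples of `n` would force one of the parameters to be `0` or `n
/ 2`. -/
theorem dvdCount_le_one {n : ℕ} {a b c : ℤ} (ha : 0 < a) (ha' : 2 * a < n) (hb : 0 < b)
    (hb' : 2 * b < n) (hc : 0 < c) (hc' : 2 * c < n) : dvdCount n a b c ≤ 1 := by
  rw [dvdCount_of_le (by omega) (by omega) (by omega) (by omega) (by omega) (by omega) (by omega)]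
  split_ifs <;> omega

theorem dvdCount_half_zero_zero {n : ℕ} {h : ℤ} (h0 : 0 < h) (hn : 2 * h = n) :
    dvdCount n h 0 0 = 0 := by
  rw [dvdCount_of_le (by omega) (by omega) (by omega) (by omega) (by omega) (by omega) (by omega)]
  split_ifs <;> omega

theorem dvdCount_half_half_zero {n : ℕ} {h : ℤ} (h0 : 0 < h) (hn : 2 * h = n) :
    dvdCount n h h 0 = 4 := by
  rw [dvdCount_of_le (by omega) (by omega) (by omega) (by omega) (by omega) (by omega) (by omega)]
  split_ifs <;> omega

theorem dvdCount_half_half_half {n : ℕ} {h : ℤ} (h0 : 0 < h) (hn : 2 * h = n) :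
    dvdCount n h h h = 0 := by
  rw [dvdCount_of_le (by omega) (by omega) (by omega) (by omega) (by omega) (by omega) (by omega)]
  split_ifs <;> omega

theorem dvdCount_half_zero {n : ℕ} {a h : ℤ} (h0 : 0 < h) (hn : 2 * h = n) (ha : 0 < a)
    (ha' : 2 * a < n) : dvdCount n h 0 a = 0 := by
  rw [dvdCount_of_le (by omega) (by omega) (by omega) (by omega) (by omega) (by omega) (by omega)]
  split_ifs <;> omega

theorem dvdCount_half_half {n : ℕ} {a h : ℤ} (h0 : 0 < h) (hn : 2 * h = n) (ha : 0 < a)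
    (ha' : 2 * a < n) : dvdCount n h h a = 0 := by
  rw [dvdCount_of_le (by omega) (by omega) (by omega) (by omega) (by omega) (by omega) (by omega)]
  split_ifs <;> omega

theorem dvdCount_half {n : ℕ} {a b h : ℤ} (h0 : 0 < h) (hn : 2 * h = n) (ha : 0 < a)
    (ha' : 2 * a < n) (hb : 0 < b) (hb' : 2 * b < n) :
    dvdCount n h a b = if a + b = h then 2 else 0 := by
  rw [dvdCount_of_le (by omega) (by omega) (by omega) (by omega) (by omega) (by omega) (by omega)]
  split_ifs <;> omega

theorem dvdCount_zero_le {n : ℕ} {a b : ℤ} (ha : 0 < a) (ha' : 2 * a ≤ n) (hb : 0 < b)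
    (hb' : 2 * b ≤ n) : dvdCount n 0 a b ≤ 4 := by
  rw [dvdCount_of_le (by omega) (by omega) (by omega) (by omega) (by omega) (by omega) (by omega)]
  split_ifs <;> omega

theorem dvdCount_le_two {n : ℕ} {a b c : ℤ} (ha : 0 < a) (ha' : 2 * a ≤ n) (hb : 0 < b)
    (hb' : 2 * b ≤ n) (hc : 0 < c) (hc' : 2 * c ≤ n) : dvdCount n a b c ≤ 2 := by
  rw [dvdCount_of_le (by omega) (by omega) (by omega) (by omega) (by omega) (by omega) (by omega)]
  split_ifs <;> omega

theorem dvdInd_neg (n : ℕ) (x : ℤ) : dvdInd n (-x) = dvdInd n x := by simp [dvdInd]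

theorem dvdCount_comm (n : ℕ) (a b c : ℤ) : dvdCount n a b c = dvdCount n b a c := by
  simp only [dvdCount]
  rw [← dvdInd_neg n (a - b + c), ← dvdInd_neg n (a - b - c)]
  ring_nf

theorem dvdCount_comm' (n : ℕ) (a b c : ℤ) : dvdCount n a b c = dvdCount n a c b := by
  simp only [dvdCount]
  ring_nf

/-! ### Rows: orthogonality and integrality -/

/-- Labels for the rows of the tables: the trivial and the Steinberg character, the principal and
the discrete series, and the constituents of the reducible members of the latter two. -/
inductive RowLabel
  | one | st | p (a : ℕ) | d (b : ℕ) | hp (s : Fin 2) | hd (s : Fin 2)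
  deriving DecidableEq

namespace RowLabel

/-- The coefficient at the principal series. -/
noncomputable def α : RowLabel → ℂ
  | one => 1 / 2 | st => 1 / 2 | p _ => 1 | d _ => 0 | hp _ => 1 / 2 | hd _ => 0

/-- The coefficient at the discrete series. -/
noncomputable def β : RowLabel → ℂ
  | one => -(1 / 2) | st => 1 / 2 | p _ => 0 | d _ => 1 | hp _ => 0 | hd _ => 1 / 2

/-- The coefficient at the class function that takes opposite values on the unipotent classes. -/
noncomputable def γ : RowLabel → ℂ
  | one => 0 | st => 0 | p _ => 0 | d _ => 0
  | hp s => (-1) ^ param s / 2 | hd s => (-1) ^ param s / 2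

/-- The parameter in the principal series. -/
def a (M : ℕ) : RowLabel → ℤ
  | one => 0 | st => 0 | p a => a | d _ => 0 | hp _ => (M / 2 : ℕ) | hd _ => 0

/-- The parameter in the discrete series. -/
def b (N : ℕ) : RowLabel → ℤ
  | one => 0 | st => 0 | p _ => 0 | d b => b | hp _ => 0 | hd _ => (N / 2 : ℕ)

/-- Only the halves of `D(N / 2)` are not real: they occur for `η = -1`, where `ξ` is imaginary. -/
def dual : RowLabel → RowLabel
  | hd s => hd s.rev
  | x => x

/-- By symmetry of `tripleForm` only triples with increasing tags matter. Constituents of reducible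
characters come first, so the first label decides which kind of case analysis applies. -/
def tag : RowLabel → ℕ
  | hp _ => 0 | hd _ => 1 | one => 2 | st => 3 | p _ => 4 | d _ => 5

/-- The ranges of the parameters. -/
def Valid (g M N : ℕ) (η : ℤ) : RowLabel → Prop
  | one => True
  | st => True
  | p a => 0 < a ∧ 2 * a < M
  | d b => 0 < b ∧ 2 * b < N
  | hp _ => g = 2 ∧ η = 1 ∧ 0 < M / 2 ∧ 2 * (M / 2) = M
  | hd _ => g = 2 ∧ η = -1 ∧ 0 < N / 2 ∧ 2 * (N / 2) = N

end RowLabel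

/-- The multiplicity of the trivial character in the product of three characters. -/
noncomputable def tripleForm (g M N : ℕ) (η : ℤ) (x y z : RowLabel) : ℂ :=
  x.α * y.α * z.α * (g + dvdCount M (x.a M) (y.a M) (z.a M)) +
  g * (x.α * y.α * z.β + x.α * y.β * z.α + x.β * y.α * z.α + x.α * y.β * z.β +
    x.β * y.α * z.β + x.β * y.β * z.α) +
  x.β * y.β * z.β * (g - dvdCount N (x.b N) (y.b N) (z.b N)) +
  g * η * (x.γ * y.γ * (z.α - z.β) + x.γ * z.γ * (y.α - y.β) + y.γ * z.γ * (x.α - x.β))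

theorem tripleForm_comm (g M N : ℕ) (η : ℤ) (x y z : RowLabel) :
    tripleForm g M N η x y z = tripleForm g M N η y x z := by
  simp only [tripleForm, dvdCount_comm _ (y.a M), dvdCount_comm _ (y.b N)]
  ring

theorem tripleForm_comm' (g M N : ℕ) (η : ℤ) (x y z : RowLabel) :
    tripleForm g M N η x y z = tripleForm g M N η x z y := by
  simp only [tripleForm, dvdCount_comm' _ _ (z.a M), dvdCount_comm' _ _ (z.b N)]
  ring

namespace RowLabel

theorem exists_nat_tripleForm_principal {g M N : ℕ} {η : ℤ} {y z : RowLabel} (s : Fin 2)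
    (hx : (hp s).Valid g M N η) (hy : y.Valid g M N η) (hz : z.Valid g M N η)
    (hy' : (hp s).tag ≤ y.tag) (hyz : y.tag ≤ z.tag) :
    ∃ n : ℕ, tripleForm g M N η (hp s) y z = n := by
  obtain ⟨h, rfl⟩ : ∃ h, M = 2 * h := ⟨_, hx.2.2.2.symm⟩
  obtain ⟨rfl, rfl, h0, -⟩ := hx
  have hn : 2 * (h : ℤ) = (2 * h : ℕ) := by simp
  have e1 : dvdCount (2 * h) h 0 0 = 0 := dvdCount_half_zero_zero (by omega) hn
  have e2 : dvdCount (2 * h) h h 0 = 4 := dvdCount_half_half_zero (by omega) hn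
  have e3 : dvdCount (2 * h) h h h = 0 := dvdCount_half_half_half (by omega) hn
  have e4 : ∀ a : ℕ, 0 < a → 2 * a < 2 * h → dvdCount (2 * h) h 0 a = 0 := fun a ha ha' =>
    dvdCount_half_zero (by omega) hn (by omega) (by omega)
  have e5 : ∀ a : ℕ, 0 < a → 2 * a < 2 * h → dvdCount (2 * h) h h a = 0 := fun a ha ha' =>
    dvdCount_half_half (by omega) hn (by omega) (by omega)
  have e6 : ∀ a b : ℕ, 0 < a → 2 * a < 2 * h → 0 < b → 2 * b < 2 * h →
      dvdCount (2 * h) h a b = if (a : ℤ) + b = h then 2 else 0 := fun a b ha ha' hb hb' =>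
    dvdCount_half (by omega) hn (by omega) (by omega) (by omega) (by omega)
  have e7 : 2 * h / 2 = h := by omega
  rcases y with _ | _ | a₂ | b₂ | s₂ | s₂ <;>
    rcases z with _ | _ | a₃ | b₃ | s₃ | s₃ <;>
    simp only [tag, Nat.reduceLeDiff, Nat.le_refl] at hyz hy' <;>
    simp only [Valid, reduceCtorEq, Int.reduceNeg, false_and, and_false] at hy hz <;>
    simp only [tripleForm, α, β, γ, a, b, zero_mul, mul_zero, add_zero, zero_add, mul_one,
      sub_zero, e7, e1, e2, e3, e4, e5, e6, hy, hz] <;>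
    (try fin_cases s) <;> (try fin_cases s₂) <;> (try fin_cases s₃) <;> simp [param] <;>
    (try split_ifs) <;>
    first
      | (refine ⟨0, ?_⟩; norm_num; done)
      | (refine ⟨1, ?_⟩; norm_num; done)
      | (refine ⟨2, ?_⟩; norm_num; done)

theorem exists_nat_tripleForm_discrete {g M N : ℕ} {η : ℤ} {y z : RowLabel} (s : Fin 2)
    (hx : (hd s).Valid g M N η) (hy : y.Valid g M N η) (hz : z.Valid g M N η)
    (hy' : (hd s).tag ≤ y.tag) (hyz : y.tag ≤ z.tag) :
    ∃ n : ℕ, tripleForm g M N η (hd s) y z = n := by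
  obtain ⟨h, rfl⟩ : ∃ h, N = 2 * h := ⟨_, hx.2.2.2.symm⟩
  obtain ⟨rfl, rfl, h0, -⟩ := hx
  have hn : 2 * (h : ℤ) = (2 * h : ℕ) := by simp
  have e1 : dvdCount (2 * h) h 0 0 = 0 := dvdCount_half_zero_zero (by omega) hn
  have e2 : dvdCount (2 * h) h h 0 = 4 := dvdCount_half_half_zero (by omega) hn
  have e3 : dvdCount (2 * h) h h h = 0 := dvdCount_half_half_half (by omega) hn
  have e4 : ∀ a : ℕ, 0 < a → 2 * a < 2 * h → dvdCount (2 * h) h 0 a = 0 := fun a ha ha' =>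
    dvdCount_half_zero (by omega) hn (by omega) (by omega)
  have e5 : ∀ a : ℕ, 0 < a → 2 * a < 2 * h → dvdCount (2 * h) h h a = 0 := fun a ha ha' =>
    dvdCount_half_half (by omega) hn (by omega) (by omega)
  have e6 : ∀ a b : ℕ, 0 < a → 2 * a < 2 * h → 0 < b → 2 * b < 2 * h →
      dvdCount (2 * h) h a b = if (a : ℤ) + b = h then 2 else 0 := fun a b ha ha' hb hb' =>
    dvdCount_half (by omega) hn (by omega) (by omega) (by omega) (by omega)
  have e7 : 2 * h / 2 = h := by omega
  rcases y with _ | _ | a₂ | b₂ | s₂ | s₂ <;>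
    rcases z with _ | _ | a₃ | b₃ | s₃ | s₃ <;>
    simp only [tag, Nat.reduceLeDiff, Nat.le_refl] at hyz hy' <;>
    simp only [Valid, Int.reduceNeg] at hy hz <;>
    simp only [tripleForm, α, β, γ, a, b, zero_mul, mul_zero, add_zero, zero_add, mul_one,
      sub_zero, e7, e1, e2, e3, e4, e5, e6, hy, hz] <;>
    (try fin_cases s) <;> (try fin_cases s₂) <;> (try fin_cases s₃) <;> simp [param] <;>
    (try split_ifs) <;>
    first
      | (refine ⟨0, ?_⟩; norm_num; done)
      | (refine ⟨1, ?_⟩; norm_num; done)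

theorem exists_nat_tripleForm_irreducible {g M N : ℕ} {η : ℤ} (hg : g = 1 ∨ g = 2)
    {x y z : RowLabel} (hx : x.Valid g M N η) (hy : y.Valid g M N η) (hz : z.Valid g M N η)
    (hx' : 2 ≤ x.tag) (hxy : x.tag ≤ y.tag) (hyz : y.tag ≤ z.tag) :
    ∃ n : ℕ, tripleForm g M N η x y z = n := by
  have e1 : ∀ {M} (a : ℕ), 0 < a → 2 * a < M → dvdCount M 0 0 a = 0 := fun a ha ha' =>
    dvdCount_zero_zero (by omega) (by omega)
  have e2 : ∀ {M} (a b : ℕ), 0 < a → 2 * a < M → 0 < b → 2 * b < M →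
      dvdCount M 0 a b = if (a : ℤ) = b then 2 else 0 := fun a b ha ha' hb hb' =>
    dvdCount_zero (by omega) (by omega) (by omega) (by omega)
  -- Written this way, the bound by `1` lets `split_ifs` replace the count by the numerals `0` and
  -- `1`.
  have e3 : ∀ {M} (a b c : ℕ), 0 < a → 2 * a < M → 0 < b → 2 * b < M → 0 < c → 2 * c < M →
      dvdCount M a b c = if dvdCount M a b c = 0 then 0 else 1 := by
    intro M a b c ha ha' hb hb' hc hc'
    have := dvdCount_le_one (n := M) (a := a) (b := b) (c := c) (by omega) (by omega) (by omega)
      (by omega) (by omega) (by omega)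
    split_ifs <;> omega
  rcases x with _ | _ | a₁ | b₁ | s₁ | s₁ <;>
    simp only [tag, Nat.reduceLeDiff, Nat.le_refl] at hx' <;>
    rcases y with _ | _ | a₂ | b₂ | s₂ | s₂ <;>
    simp only [tag, Nat.reduceLeDiff, Nat.le_refl] at hxy <;>
    rcases z with _ | _ | a₃ | b₃ | s₃ | s₃ <;>
    simp only [tag, Nat.reduceLeDiff, Nat.le_refl] at hyz <;>
    simp only [Valid] at hx hy hz <;>
    simp only [tripleForm, α, β, γ, a, b, zero_mul, mul_zero, add_zero, zero_add, mul_one,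
      sub_zero, dvdCount_zero_zero_zero, e1, e2, hx, hy, hz] <;>
    (try rw [e3 a₁ a₂ a₃ hx.1 hx.2 hy.1 hy.2 hz.1 hz.2]) <;>
    (try rw [e3 b₁ b₂ b₃ hx.1 hx.2 hy.1 hy.2 hz.1 hz.2]) <;>
    rcases hg with rfl | rfl <;> (try split_ifs) <;>
    first
      | (refine ⟨0, ?_⟩; norm_num; done)
      | (refine ⟨1, ?_⟩; norm_num; done)
      | (refine ⟨2, ?_⟩; norm_num; done)
      | (refine ⟨3, ?_⟩; norm_num; done)

/-- Since the trivial row is `(P(0) - D(0)) / 2`, the terms with `g` alone cancel, and so do the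
pairings between the two series. -/
theorem tripleForm_one (g M N : ℕ) (η : ℤ) (x y : RowLabel) : tripleForm g M N η one x y =
    (x.α * y.α * dvdCount M 0 (x.a M) (y.a M) + x.β * y.β * dvdCount N 0 (x.b N) (y.b N)) / 2 +
      g * η * x.γ * y.γ := by
  simp only [tripleForm, α.eq_1, β.eq_1, γ.eq_1, a.eq_1, b.eq_1]
  ring

theorem dvdCount_zero_mid {n : ℕ} {a : ℤ} (ha : 0 < a) (ha' : 2 * a ≤ n) :
    dvdCount n 0 a 0 = 0 := by
  rw [dvdCount_comm', dvdCount_zero_zero ha ha']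

theorem tripleForm_one_eq {g M N : ℕ} {η : ℤ} (x y : RowLabel) (hx : x.Valid g M N η)
    (hy : y.Valid g M N η) : tripleForm g M N η one x y = if y = x.dual then 1 else 0 := by
  have e1 : ∀ {M} (a : ℕ), 0 < a → 2 * a ≤ M → dvdCount M 0 0 a = 0 := fun a ha ha' =>
    dvdCount_zero_zero (by omega) (by omega)
  have e1' : ∀ {M} (a : ℕ), 0 < a → 2 * a ≤ M → dvdCount M 0 a 0 = 0 := fun a ha ha' =>
    dvdCount_zero_mid (by omega) (by omega)
  -- The value `4` occurs at `M / 2`. It gives `1 / 2` for two halves of the same reducible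
  -- character, and the `γ` term `±1 / 2` completes this to `1` or `0`.
  have e2 : ∀ {M} (a b : ℕ), 0 < a → 2 * a ≤ M → 0 < b → 2 * b ≤ M → dvdCount M 0 a b =
      if a = b then if 2 * a = M then 4 else 2 else 0 := by
    intro M a b ha ha' hb hb'
    rw [dvdCount_of_le (by omega) (by omega) (by omega) (by omega) (by omega) (by omega) (by omega)]
    split_ifs <;> omega
  rw [tripleForm_one]
  rcases x with _ | _ | a₂ | b₂ | s₂ | s₂ <;>
    rcases y with _ | _ | a₃ | b₃ | s₃ | s₃ <;>
    simp only [Valid] at hx hy <;>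
    simp (disch := omega) only [α, β, γ, a, b, zero_mul, mul_zero, add_zero, zero_add, mul_one,
      one_mul, dvdCount_zero_zero_zero, e1, e1', e2] <;>
    (try (rw [hx.1, hx.2.1])) <;>
    (try fin_cases s₂) <;> (try fin_cases s₃) <;> simp [dual, param] <;>
    (try split_ifs) <;> first | omega | (norm_num; done)

theorem exists_nat_tripleForm {g M N : ℕ} {η : ℤ} (hg : g = 1 ∨ g = 2)
    (x y z : RowLabel) (hx : x.Valid g M N η) (hy : y.Valid g M N η) (hz : z.Valid g M N η) :
    ∃ n : ℕ, tripleForm g M N η x y z = n := by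
  have key : ∀ {x y z : RowLabel}, x.Valid g M N η → y.Valid g M N η → z.Valid g M N η →
      x.tag ≤ y.tag → y.tag ≤ z.tag → ∃ n : ℕ, tripleForm g M N η x y z = n := by
    intro x y z hx hy hz hxy hyz
    by_cases hx' : 2 ≤ x.tag
    · exact exists_nat_tripleForm_irreducible hg hx hy hz hx' hxy hyz
    · rcases x with _ | _ | a | b | s | s
      case hp => exact exists_nat_tripleForm_principal s hx hy hz hxy hyz
      case hd => exact exists_nat_tripleForm_discrete s hx hy hz hxy hyz
      all_goals simp [tag] at hx'
  have key' : ∀ {x y z : RowLabel}, x.Valid g M N η → y.Valid g M N η → z.Valid g M N η →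
      x.tag ≤ y.tag → ∃ n : ℕ, tripleForm g M N η x y z = n := by
    intro x y z hx hy hz hxy
    rcases le_total y.tag z.tag with h | h
    · exact key hx hy hz hxy h
    · rw [tripleForm_comm']
      rcases le_total x.tag z.tag with h' | h'
      · exact key hx hz hy h' h
      · rw [tripleForm_comm]
        exact key hz hx hy h' hxy
  rcases le_total x.tag y.tag with h | h
  · exact key' hx hy hz h
  · rw [tripleForm_comm]
    exact key' hy hx hz h

end RowLabel

/-- The sum over the columns in terms of the labels of three rows. -/
theorem sum_columns_eq_tripleForm {g M N : ℕ} {η : ℤ} {q ξ : ℂ} (hM : M ≠ 0) (hN : N ≠ 0)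
    (hg : g ≠ 0) (hq : q ≠ 0) (hqM : (g : ℂ) * M = q - 1) (hqN : (g : ℂ) * N = q + 1)
    (hξ : ξ ^ 2 = η * q) (x y z : RowLabel) :
    g / (q * (q ^ 2 - 1)) * ((x.α * (q + 1) + x.β * (q - 1)) * (y.α * (q + 1) + y.β * (q - 1)) *
      (z.α * (q + 1) + z.β * (q - 1))) +
    g / (2 * q) * ((x.α - x.β + x.γ * ξ) * (y.α - y.β + y.γ * ξ) * (z.α - z.β + z.γ * ξ) +
      (x.α - x.β - x.γ * ξ) * (y.α - y.β - y.γ * ξ) * (z.α - z.β - z.γ * ξ)) +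
    halfSum M (fun k => (M : ℂ)⁻¹ * ((x.α * zetaTrace M (k * x.a M)) *
      (y.α * zetaTrace M (k * y.a M)) * (z.α * zetaTrace M (k * z.a M)))) +
    halfSum N (fun k => (N : ℂ)⁻¹ * ((-x.β * zetaTrace N (k * x.b N)) *
      (-y.β * zetaTrace N (k * y.b N)) * (-z.β * zetaTrace N (k * z.b N)))) =
    tripleForm g M N η x y z := by
  have h1 := halfSum_zetaTrace_mul hM ((M : ℂ)⁻¹ * (x.α * y.α * z.α)) (x.a M) (y.a M) (z.a M)
  have h2 := halfSum_zetaTrace_mul hN (-(N : ℂ)⁻¹ * (x.β * y.β * z.β)) (x.b N) (y.b N) (z.b N)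
  have hM' : (M : ℂ) ≠ 0 := by exact_mod_cast hM
  have hN' : (N : ℂ) ≠ 0 := by exact_mod_cast hN
  have hg' : (g : ℂ) ≠ 0 := by exact_mod_cast hg
  have hq1 : q - 1 ≠ 0 := hqM ▸ mul_ne_zero hg' hM'
  have hq2 : q + 1 ≠ 0 := hqN ▸ mul_ne_zero hg' hN'
  have hq3 : q ^ 2 - 1 = (q - 1) * (q + 1) := by ring
  have hMi : (M : ℂ) = (q - 1) / g := by rw [← hqM]; field_simp
  have hNi : (N : ℂ) = (q + 1) / g := by rw [← hqN]; field_simp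
  have h3 : halfSum M (fun k => (M : ℂ)⁻¹ * ((x.α * zetaTrace M (k * x.a M)) *
      (y.α * zetaTrace M (k * y.a M)) * (z.α * zetaTrace M (k * z.a M)))) =
      x.α * y.α * z.α * (dvdCount M (x.a M) (y.a M) (z.a M) - 4 * g / (q - 1)) := by
    calc _ = _ := by congr 1; funext k; ring
      _ = _ := h1
      _ = _ := by rw [hMi]; field_simp
  have h4 : halfSum N (fun k => (N : ℂ)⁻¹ * ((-x.β * zetaTrace N (k * x.b N)) *
      (-y.β * zetaTrace N (k * y.b N)) * (-z.β * zetaTrace N (k * z.b N)))) =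
      -(x.β * y.β * z.β * (dvdCount N (x.b N) (y.b N) (z.b N) - 4 * g / (q + 1))) := by
    calc _ = _ := by congr 1; funext k; ring
      _ = _ := h2
      _ = _ := by rw [hNi]; field_simp
  -- Odd powers of `ξ` cancel between the two unipotent columns, so only `ξ ^ 2 = η * q` survives.
  have h5 : (x.α - x.β + x.γ * ξ) * (y.α - y.β + y.γ * ξ) * (z.α - z.β + z.γ * ξ) +
      (x.α - x.β - x.γ * ξ) * (y.α - y.β - y.γ * ξ) * (z.α - z.β - z.γ * ξ) =
      2 * ((x.α - x.β) * (y.α - y.β) * (z.α - z.β) + η * q * (x.γ * y.γ * (z.α - z.β) +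
        x.γ * z.γ * (y.α - y.β) + y.γ * z.γ * (x.α - x.β))) := by
    rw [← hξ]; ring
  rw [h3, h4, h5, tripleForm, hq3]
  generalize (dvdCount M (x.a M) (y.a M) (z.a M) : ℂ) = e₁
  generalize (dvdCount N (x.b N) (y.b N) (z.b N) : ℂ) = e₂
  field_simp
  ring

/-! ### Columns: nonnegativity of the Schur sums -/

/-- Labels for the columns of the tables other than the first one: unipotent elements, elements of
the split torus and elements of the nonsplit torus. -/
inductive ColLabel
  | u (σ : ℤ) | s (k : ℕ) | n (k : ℕ)

namespace ColLabel

/-- The coefficient at the principal series. -/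
noncomputable def α : ColLabel → ℝ
  | u _ => 1 / 2 | s _ => 1 | n _ => 0

/-- The coefficient at the discrete series. -/
noncomputable def β : ColLabel → ℝ
  | u _ => 1 / 2 | s _ => 0 | n _ => 1

/-- The sign that distinguishes the unipotent classes. -/
def σ : ColLabel → ℤ
  | u σ => σ | s _ => 0 | n _ => 0

/-- The parameter in the split torus. -/
def a : ColLabel → ℤ
  | u _ => 0 | s k => k | n _ => 0

/-- The parameter in the nonsplit torus. -/
def b : ColLabel → ℤ
  | u _ => 0 | s _ => 0 | n k => k

/-- The value of the quadratic character. -/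
def τ : ColLabel → ℤ
  | u _ => 1 | s k => (-1) ^ k | n k => (-1) ^ k

def tag : ColLabel → ℕ
  | u _ => 0 | s _ => 1 | n _ => 2

/-- The ranges of the parameters. -/
def Valid (g M N : ℕ) : ColLabel → Prop
  | u σ => g = 1 ∧ σ = 0 ∨ g = 2 ∧ (σ = 1 ∨ σ = -1)
  | s k => 0 < k ∧ 2 * k ≤ M
  | n k => 0 < k ∧ 2 * k ≤ N

end ColLabel

/-- The value of the sum of the Schur product criterion at three columns. -/
noncomputable def schurForm (q : ℝ) (M N : ℕ) (η : ℤ) (x y z : ColLabel) : ℝ :=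
  1 + (x.α - x.β) * (y.α - y.β) * (z.α - z.β) / q +
  x.α * y.α * z.α * (M * dvdCount M x.a y.a z.a - 4) / (q + 1) -
  x.β * y.β * z.β * (N * dvdCount N x.b y.b z.b - 4) / (q - 1) +
  if η = 1 then q / (q + 1) * (x.σ * y.σ * (z.α * z.τ) + x.σ * z.σ * (y.α * y.τ) +
      y.σ * z.σ * (x.α * x.τ))
  else q / (q - 1) * (x.σ * y.σ * (z.β * z.τ) + x.σ * z.σ * (y.β * y.τ) + y.σ * z.σ * (x.β * x.τ))

theorem schurForm_comm (q : ℝ) (M N : ℕ) (η : ℤ) (x y z : ColLabel) :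
    schurForm q M N η x y z = schurForm q M N η y x z := by
  simp only [schurForm, dvdCount_comm _ y.a, dvdCount_comm _ y.b]
  split_ifs <;> ring

theorem schurForm_comm' (q : ℝ) (M N : ℕ) (η : ℤ) (x y z : ColLabel) :
    schurForm q M N η x y z = schurForm q M N η x z y := by
  simp only [schurForm, dvdCount_comm' _ _ z.a, dvdCount_comm' _ _ z.b]
  split_ifs <;> ring

/-- Counts on the split torus enter with a positive sign and need no bound. Those on the nonsplit
torus enter negatively and must be bounded in terms of `g`; for `g = 1` the oddness of `N` keeps the
parameters off `N / 2`, where the counts double. -/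
theorem schurForm_nonneg_of_tag_le {q : ℝ} {g M N : ℕ} {η : ℤ} (hq : 0 < q) (hM : M ≠ 0)
    (hN : N ≠ 0) (hg : g = 1 ∨ g = 2) (hgN : g = 1 → Odd N)
    (hqM : (g : ℝ) * M = q - 1) (hqN : (g : ℝ) * N = q + 1) {x y z : ColLabel}
    (hx : x.Valid g M N) (hy : y.Valid g M N) (hz : z.Valid g M N)
    (hxy : x.tag ≤ y.tag) (hyz : y.tag ≤ z.tag) : 0 ≤ schurForm q M N η x y z := by
  have hM1 : (1 : ℝ) ≤ M := by exact_mod_cast Nat.one_le_iff_ne_zero.mpr hM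
  have hgM : (g : ℝ) ≤ q - 1 := by rw [← hqM]; exact le_mul_of_one_le_right (by positivity) hM1
  have hg1 : (1 : ℝ) ≤ g := by rcases hg with rfl | rfl <;> norm_num
  have hq2 : 2 ≤ q := by linarith
  have hq1 : 0 < q - 1 := by linarith
  have hMi : (M : ℝ) = (q - 1) / g := by rw [← hqM]; field_simp
  have hNi : (N : ℝ) = (q + 1) / g := by rw [← hqN]; field_simp
  rcases x with σ₁ | k₁ | k₁ <;> rcases y with σ₂ | k₂ | k₂ <;>
    simp only [ColLabel.tag, Nat.reduceLeDiff, Nat.le_refl] at hxy <;>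
    rcases z with σ₃ | k₃ | k₃ <;>
    simp only [ColLabel.tag, Nat.reduceLeDiff, Nat.le_refl] at hyz <;>
    simp only [ColLabel.Valid] at hx hy hz <;>
    simp only [schurForm, ColLabel.α, ColLabel.β, ColLabel.σ, ColLabel.a, ColLabel.b, ColLabel.τ,
      Int.cast_zero, zero_mul, mul_zero, add_zero, one_mul, mul_one, sub_zero,
      sub_self, zero_div, ite_self]
  case u.u.u =>
    have h8 : ((dvdCount M 0 0 0 : ℕ) : ℝ) = 4 := by rw [dvdCount_zero_zero_zero]; norm_num
    have h9 : ((dvdCount N 0 0 0 : ℕ) : ℝ) = 4 := by rw [dvdCount_zero_zero_zero]; norm_num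
    rw [h8, h9]
    -- Among three signs two agree, so the sum of pairwise products is `3` or `-1`.
    have hA : g = 1 ∧ (σ₁ * σ₂ + σ₁ * σ₃ + σ₂ * σ₃ : ℝ) = 0 ∨
        g = 2 ∧ -1 ≤ (σ₁ * σ₂ + σ₁ * σ₃ + σ₂ * σ₃ : ℝ) := by
      rcases hx with ⟨h, rfl⟩ | ⟨h, rfl | rfl⟩ <;> rcases hy with ⟨h', rfl⟩ | ⟨h', rfl | rfl⟩ <;>
        rcases hz with ⟨h'', rfl⟩ | ⟨h'', rfl | rfl⟩ <;>
        first | omega | (left; refine ⟨h, ?_⟩; norm_num) | (right; refine ⟨h, ?_⟩; norm_num)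
    have e : (σ₁ * σ₂ * (1 / 2 * ((1 : ℤ) : ℝ)) + σ₁ * σ₃ * (1 / 2 * ((1 : ℤ) : ℝ)) +
        σ₂ * σ₃ * (1 / 2 * ((1 : ℤ) : ℝ)) : ℝ) = (σ₁ * σ₂ + σ₁ * σ₃ + σ₂ * σ₃) / 2 := by
      push_cast; ring
    rw [e, hMi, hNi]
    generalize (σ₁ * σ₂ + σ₁ * σ₃ + σ₂ * σ₃ : ℝ) = A at hA
    rcases hA with ⟨rfl, rfl⟩ | ⟨rfl, hA⟩
    · have : 1 + 1 / 2 * (1 / 2) * (1 / 2) * ((q - 1) / (1 : ℕ) * 4 - 4) / (q + 1) -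
          1 / 2 * (1 / 2) * (1 / 2) * ((q + 1) / (1 : ℕ) * 4 - 4) / (q - 1) =
          q * (q - 2) / ((q + 1) * (q - 1)) := by
        field_simp
        push_cast
        ring
      rw [this]
      have : 0 ≤ q - 2 := by linarith
      split_ifs <;> simp <;> positivity
    · have : 1 + 1 / 2 * (1 / 2) * (1 / 2) * ((q - 1) / (2 : ℕ) * 4 - 4) / (q + 1) -
          1 / 2 * (1 / 2) * (1 / 2) * ((q + 1) / (2 : ℕ) * 4 - 4) / (q - 1) = q / (q + 1) := by
        field_simp
        push_cast
        ring
      rw [this]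
      split_ifs
      · have h2 : 0 ≤ 1 + A / 2 := by linarith
        calc 0 ≤ q / (q + 1) * (1 + A / 2) := by positivity
          _ = _ := by ring
      · have h2 : q / (q - 1) * (-(1 / 2)) ≤ q / (q - 1) * (A / 2) := by
          gcongr; linarith
        have h3 : q / (q + 1) + q / (q - 1) * (-(1 / 2)) =
            q * (q - 3) / (2 * ((q + 1) * (q - 1))) := by
          field_simp
          ring
        -- This is where `g = 2` and `M ≥ 1` are needed; the bound is attained at `q = 3`.
        have h4 : 0 ≤ q - 3 := by push_cast at hgM; linarith
        have h5 : 0 ≤ q * (q - 3) / (2 * ((q + 1) * (q - 1))) := by positivity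
        linarith
  case u.u.s =>
    rw [dvdCount_zero_zero (by omega) (by omega)]
    have h2 : (-1 : ℝ) ≤ σ₁ * σ₂ * ((-1) ^ k₃ : ℤ) := by
      rcases hx with ⟨h, rfl⟩ | ⟨h, rfl | rfl⟩ <;> rcases hy with ⟨h', rfl⟩ | ⟨h', rfl | rfl⟩ <;>
        rcases neg_one_pow_eq_or ℤ k₃ with h | h <;> rw [h] <;> norm_num
    have h3 : 1 + 1 / 2 * (1 / 2) * (M * ((0 : ℕ) : ℝ) - 4) / (q + 1) = q / (q + 1) := by
      field_simp
      push_cast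
      ring
    rw [h3]
    split_ifs
    · have h4 : 0 ≤ 1 + σ₁ * σ₂ * (((-1) ^ k₃ : ℤ) : ℝ) := by linarith
      calc 0 ≤ q / (q + 1) * (1 + σ₁ * σ₂ * (((-1) ^ k₃ : ℤ) : ℝ)) := by positivity
        _ = _ := by ring
    · positivity
  case u.u.n =>
    rw [dvdCount_zero_zero (by omega) (by omega)]
    have h2 : (-1 : ℝ) ≤ σ₁ * σ₂ * ((-1) ^ k₃ : ℤ) := by
      rcases hx with ⟨h, rfl⟩ | ⟨h, rfl | rfl⟩ <;> rcases hy with ⟨h', rfl⟩ | ⟨h', rfl | rfl⟩ <;>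
        rcases neg_one_pow_eq_or ℤ k₃ with h | h <;> rw [h] <;> norm_num
    have h3 : 1 - 1 / 2 * (1 / 2) * (N * ((0 : ℕ) : ℝ) - 4) / (q - 1) = q / (q - 1) := by
      field_simp
      push_cast
      ring
    rw [h3]
    split_ifs
    · positivity
    · have h4 : 0 ≤ 1 + σ₁ * σ₂ * (((-1) ^ k₃ : ℤ) : ℝ) := by linarith
      calc 0 ≤ q / (q - 1) * (1 + σ₁ * σ₂ * (((-1) ^ k₃ : ℤ) : ℝ)) := by positivity
        _ = _ := by ring
  case u.s.s =>
    have h2 : 0 ≤ (M : ℝ) * dvdCount M 0 k₂ k₃ := by positivity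
    have h3 : 1 + 1 / 2 * ((M : ℝ) * dvdCount M 0 k₂ k₃ - 4) / (q + 1) =
        (q - 1 + M * dvdCount M 0 k₂ k₃ / 2) / (q + 1) := by
      field_simp
      ring
    rw [h3]
    positivity
  case u.s.n => exact zero_le_one
  case u.n.n =>
    -- At count `2 * g` the whole expression vanishes, so no larger count could be tolerated.
    have h2 : dvdCount N 0 k₂ k₃ ≤ 2 * g := by
      rcases hg with rfl | rfl
      · obtain ⟨r, hr⟩ := hgN rfl
        rw [dvdCount_zero (by omega) (by omega) (by omega) (by omega)]
        split_ifs <;> omega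
      · exact dvdCount_zero_le (by omega) (by omega) (by omega) (by omega)
    have h2' : (dvdCount N 0 k₂ k₃ : ℝ) ≤ 2 * g := by exact_mod_cast h2
    have h3 : (N : ℝ) * dvdCount N 0 k₂ k₃ ≤ 2 * (q + 1) := by
      calc (N : ℝ) * dvdCount N 0 k₂ k₃ ≤ N * (2 * g) := by gcongr
        _ = 2 * (q + 1) := by rw [← hqN]; ring
    have h4 : 1 - 1 / 2 * ((N : ℝ) * dvdCount N 0 k₂ k₃ - 4) / (q - 1) =
        (2 * (q + 1) - N * dvdCount N 0 k₂ k₃) / (2 * (q - 1)) := by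
      field_simp
      ring
    rw [h4]
    exact div_nonneg (by linarith) (by linarith)
  case s.s.s =>
    have h2 : 0 ≤ (M : ℝ) * dvdCount M k₁ k₂ k₃ := by positivity
    have h3 : 1 + 1 / q + ((M : ℝ) * dvdCount M k₁ k₂ k₃ - 4) / (q + 1) =
        ((q - 1) ^ 2 + q * (M * dvdCount M k₁ k₂ k₃)) / (q * (q + 1)) := by
      field_simp
      ring
    rw [h3]
    positivity
  case s.s.n =>
    have h2 : 1 + (0 - 1) / q = (q - 1) / q := by field_simp; ring
    rw [h2]
    positivity
  case s.n.n =>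
    norm_num
    positivity
  case n.n.n =>
    have h2 : dvdCount N k₁ k₂ k₃ ≤ g := by
      rcases hg with rfl | rfl
      · obtain ⟨r, hr⟩ := hgN rfl
        exact dvdCount_le_one (by omega) (by omega) (by omega) (by omega) (by omega) (by omega)
      · exact dvdCount_le_two (by omega) (by omega) (by omega) (by omega) (by omega) (by omega)
    have h2' : (dvdCount N k₁ k₂ k₃ : ℝ) ≤ g := by exact_mod_cast h2
    have h3 : (N : ℝ) * dvdCount N k₁ k₂ k₃ ≤ q + 1 := by
      calc (N : ℝ) * dvdCount N k₁ k₂ k₃ ≤ N * g := by gcongr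
        _ = q + 1 := by rw [← hqN]; ring
    have h4 : 1 + (0 - 1) * (0 - 1) * (0 - 1) / q - ((N : ℝ) * dvdCount N k₁ k₂ k₃ - 4) / (q - 1) =
        (q + 1 + q * (q + 1 - N * dvdCount N k₁ k₂ k₃)) / (q * (q - 1)) := by
      field_simp
      ring
    rw [h4]
    have h5 : 0 ≤ q + 1 - (N : ℝ) * dvdCount N k₁ k₂ k₃ := by linarith
    positivity

theorem schurForm_nonneg {q : ℝ} {g M N : ℕ} {η : ℤ} (hq : 0 < q) (hM : M ≠ 0)
    (hN : N ≠ 0) (hg : g = 1 ∨ g = 2) (hgN : g = 1 → Odd N)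
    (hqM : (g : ℝ) * M = q - 1) (hqN : (g : ℝ) * N = q + 1) (x y z : ColLabel)
    (hx : x.Valid g M N) (hy : y.Valid g M N) (hz : z.Valid g M N) :
    0 ≤ schurForm q M N η x y z := by
  have key : ∀ {x y z : ColLabel}, x.Valid g M N → y.Valid g M N → z.Valid g M N →
      x.tag ≤ y.tag → y.tag ≤ z.tag → 0 ≤ schurForm q M N η x y z :=
    schurForm_nonneg_of_tag_le hq hM hN hg hgN hqM hqN
  have key' : ∀ {x y z : ColLabel}, x.Valid g M N → y.Valid g M N → z.Valid g M N →
      x.tag ≤ y.tag → 0 ≤ schurForm q M N η x y z := by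
    intro x y z hx hy hz hxy
    rcases le_total y.tag z.tag with h | h
    · exact key hx hy hz hxy h
    · rw [schurForm_comm']
      rcases le_total x.tag z.tag with h' | h'
      · exact key hx hz hy h' h
      · rw [schurForm_comm]
        exact key hz hx hy h' hxy
  rcases le_total x.tag y.tag with h | h
  · exact key' hx hy hz h
  · rw [schurForm_comm]
    exact key' hy hx hz h

/-- The sum over the rows, except for those of the constituents of reducible members of the
principal and the discrete series, in terms of the labels of three columns. -/
theorem sum_rows_eq {M N : ℕ} (q : ℂ) (hM : M ≠ 0) (hN : N ≠ 0) (x y z : ColLabel) :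
    1 + (x.α - x.β) * (y.α - y.β) * (z.α - z.β) / q +
    halfSum M (fun c => (q + 1)⁻¹ * ((x.α * zetaTrace M (c * x.a)) *
      (y.α * zetaTrace M (c * y.a)) * (z.α * zetaTrace M (c * z.a)))) +
    halfSum N (fun c => (q - 1)⁻¹ * ((-x.β * zetaTrace N (c * x.b)) *
      (-y.β * zetaTrace N (c * y.b)) * (-z.β * zetaTrace N (c * z.b)))) =
    1 + (x.α - x.β) * (y.α - y.β) * (z.α - z.β) / q +
      x.α * y.α * z.α * (M * dvdCount M x.a y.a z.a - 4) / (q + 1) -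
      x.β * y.β * z.β * (N * dvdCount N x.b y.b z.b - 4) / (q - 1) := by
  have h1 := halfSum_zetaTrace_mul hM ((q + 1)⁻¹ * (x.α * y.α * z.α)) x.a y.a z.a
  have h2 := halfSum_zetaTrace_mul hN (-(q - 1)⁻¹ * (x.β * y.β * z.β)) x.b y.b z.b
  have h3 : halfSum M (fun c => (q + 1)⁻¹ * ((x.α * zetaTrace M (c * x.a)) *
      (y.α * zetaTrace M (c * y.a)) * (z.α * zetaTrace M (c * z.a)))) = _ :=
    (congrArg (halfSum M) (funext fun c => by ring)).trans h1
  have h4 : halfSum N (fun c => (q - 1)⁻¹ * ((-x.β * zetaTrace N (c * x.b)) *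
      (-y.β * zetaTrace N (c * y.b)) * (-z.β * zetaTrace N (c * z.b)))) = _ :=
    (congrArg (halfSum N) (funext fun c => by ring)).trans h2
  rw [h3, h4]
  ring

/-! ### From labels to Verlinde tables -/

/-- A table whose rows carry labels so that the sums over columns are given by `tripleForm`. -/
noncomputable def VerlindeTable.ofLabel {ι κ : Type} [Fintype ι] [DecidableEq ι] [Fintype κ]
    [DecidableEq κ] {lam : ι → κ → ℂ} {j₀ : κ} {g M N : ℕ} {η : ℤ} (hg : g = 1 ∨ g = 2)
    (label : ι → RowLabel) (hinj : Function.Injective label)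
    (hvalid : ∀ i, (label i).Valid g M N η) (w : κ → ℝ) (w_pos : ∀ l, 0 < w l)
    (one : ι) (label_one : label one = .one) (one_apply : ∀ l, lam one l = 1)
    (dual : ι → ι) (label_dual : ∀ i, label (dual i) = (label i).dual)
    (dual_apply : ∀ i l, lam (dual i) l = star (lam i l))
    (dualCol : κ → κ) (dualCol_apply : ∀ i l, lam i (dualCol l) = star (lam i l))
    (card_eq : Fintype.card ι = Fintype.card κ) (pos : ∀ i, 0 < lam i j₀)
    (hsum : ∀ i j k, ∑ l, (w l : ℂ) * (lam i l * lam j l * lam k l) =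
      tripleForm g M N η (label i) (label j) (label k)) : VerlindeTable lam j₀ where
  w l := w l
  one := one
  dual := dual
  dualCol := dualCol
  card_eq := card_eq
  w_pos l := Complex.zero_lt_real.mpr (w_pos l)
  one_apply := one_apply
  dual_apply := dual_apply
  dualCol_apply := dualCol_apply
  orth i j := by
    -- Orthogonality is the triple sum with one factor the trivial row.
    have h := hsum one i j
    simp only [one_apply, one_mul] at h
    rw [h, label_one, RowLabel.tripleForm_one_eq _ _ (hvalid i) (hvalid j), ← label_dual]
    exact if_congr hinj.eq_iff rfl rfl
  exists_nat i j k := by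
    simp only [hsum]
    exact RowLabel.exists_nat_tripleForm hg _ _ _ (hvalid i) (hvalid j) (hvalid k)
  pos := pos

/-! ### The table for even `q` -/

section Even

variable {q : ℕ}

def rowLabelEven : Unit ⊕ Fin (q / 2) ⊕ Unit ⊕ Fin ((q - 2) / 2) → RowLabel
  | .inl _ => .one
  | .inr (.inl c) => .d (param c)
  | .inr (.inr (.inl _)) => .st
  | .inr (.inr (.inr c)) => .p (param c)

/-- The labels of the columns; the one of the first column has no meaning. -/
def colLabelEven : Unit ⊕ Unit ⊕ Fin ((q - 2) / 2) ⊕ Fin (q / 2) → ColLabel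
  | .inl _ => .u 0
  | .inr (.inl _) => .u 0
  | .inr (.inr (.inl k)) => .s (param k)
  | .inr (.inr (.inr k)) => .n (param k)

noncomputable def weightEven : Unit ⊕ Unit ⊕ Fin ((q - 2) / 2) ⊕ Fin (q / 2) → ℝ
  | .inl _ => 1 / (q * (q ^ 2 - 1))
  | .inr (.inl _) => 1 / q
  | .inr (.inr (.inl _)) => ((q - 1 : ℕ) : ℝ)⁻¹
  | .inr (.inr (.inr _)) => ((q + 1 : ℕ) : ℝ)⁻¹

theorem entryEven_first (i) : entryEven q i (.inl ()) =
    (rowLabelEven i).α * (q + 1) + (rowLabelEven i).β * (q - 1) := by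
  rcases i with _ | c | _ | c <;> simp [entryEven, rowLabelEven, RowLabel.α, RowLabel.β] <;> ring

theorem entryEven_unipotent (i) : entryEven q i (.inr (.inl ())) =
    (rowLabelEven i).α - (rowLabelEven i).β := by
  rcases i with _ | c | _ | c <;> norm_num [entryEven, rowLabelEven, RowLabel.α, RowLabel.β]

theorem entryEven_split (i) (k) : entryEven q i (.inr (.inr (.inl k))) =
    (rowLabelEven i).α * zetaTrace (q - 1) (param k * (rowLabelEven i).a (q - 1)) := by
  rcases i with _ | c | _ | c <;>
    simp [entryEven, rowLabelEven, RowLabel.α, RowLabel.a, zetaTrace_zero, zetaSum_eq]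

theorem entryEven_nonsplit (i) (k) : entryEven q i (.inr (.inr (.inr k))) =
    -(rowLabelEven i).β * zetaTrace (q + 1) (param k * (rowLabelEven i).b (q + 1)) := by
  rcases i with _ | c | _ | c <;>
    simp [entryEven, rowLabelEven, RowLabel.β, RowLabel.b, zetaTrace_zero, zetaSum_eq]

theorem param_injective {n : ℕ} : Function.Injective (param : Fin n → ℕ) := fun _ _ h =>
  Fin.ext (Nat.succ_injective h)

theorem param_pos {n : ℕ} (k : Fin n) : 0 < param k := Nat.succ_pos _

theorem param_le {n : ℕ} (k : Fin n) : param k ≤ n := k.isLt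

theorem rowLabelEven_injective : Function.Injective (rowLabelEven (q := q)) := by
  rintro (_ | c | _ | c) (_ | c' | _ | c') h <;> simp_all [rowLabelEven, param_injective.eq_iff]

theorem rowLabelEven_valid (i) : (rowLabelEven (q := q) i).Valid 1 (q - 1) (q + 1) 0 := by
  rcases i with _ | c | _ | c <;> simp only [rowLabelEven, RowLabel.Valid]
  · have := param_le c
    have := param_pos c
    omega
  · have := param_le c
    have := param_pos c
    omega

theorem colLabelEven_valid (i) : (colLabelEven (q := q) i).Valid 1 (q - 1) (q + 1) := by
  rcases i with _ | _ | c | c <;> simp only [colLabelEven, ColLabel.Valid]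
  · simp
  · simp
  · have := param_le c
    have := param_pos c
    omega
  · have := param_le c
    have := param_pos c
    omega

theorem star_zetaSum (n m : ℕ) : star (zetaSum n m) = zetaSum n m := by
  rw [zetaSum_eq, star_zetaTrace]

theorem star_entryEven (i j) : star (entryEven q i j) = entryEven q i j := by
  rcases i with _ | c | _ | c <;> rcases j with _ | _ | k | k <;>
    simp only [entryEven, star_sub, star_add, star_neg, star_natCast, star_one, star_zero,
      star_zetaSum]

theorem sum_weightEven (hq : 2 ≤ q) (h2 : q % 2 = 0) (x y z) :
    ∑ l, (weightEven l : ℂ) * (entryEven q x l * entryEven q y l * entryEven q z l) =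
      tripleForm 1 (q - 1) (q + 1) 0 (rowLabelEven x) (rowLabelEven y) (rowLabelEven z) := by
  have hM : ((q - 1 : ℕ) : ℂ) = q - 1 := by rw [Nat.cast_sub (by omega)]; simp
  -- With `ξ = 0` the two unipotent columns coincide; the single column carries both weights `1 / (2
  -- * q)`.
  rw [← sum_columns_eq_tripleForm (q := q) (ξ := 0) (by omega) (by omega) one_ne_zero
    (by norm_cast; omega) (by rw [hM]; simp) (by simp) (by simp),
    ← sum_param_of_odd (m := (q - 2) / 2) (by omega), ← sum_param_of_odd (m := q / 2) (by omega)]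
  simp only [Fintype.sum_sum_type, Finset.univ_unique, Finset.sum_singleton, PUnit.default_eq_unit,
    entryEven_first, entryEven_unipotent, entryEven_split, entryEven_nonsplit, weightEven]
  push_cast
  ring

theorem sum_entryEven (hq : 2 ≤ q) (h2 : q % 2 = 0) (x y z) (hx : x ≠ .inl ()) (hy : y ≠ .inl ())
    (hz : z ≠ .inl ()) :
    ∑ i, entryEven q i x * entryEven q i y * entryEven q i z / entryEven q i (.inl ()) =
      schurForm q (q - 1) (q + 1) 0 (colLabelEven x) (colLabelEven y) (colLabelEven z) := by
  have e1 : ∀ j, j ≠ .inl () → ∀ c, entryEven q (.inr (.inl c)) j =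
      -(colLabelEven j).β * zetaTrace (q + 1) (param c * (colLabelEven j).b) := by
    rintro (_ | _ | k | k) hj c
    · exact absurd rfl hj
    all_goals simp [entryEven, colLabelEven, ColLabel.β, ColLabel.b, zetaTrace_zero, zetaSum_eq,
      mul_comm (param c : ℤ)]
  have e2 : ∀ j, j ≠ .inl () → entryEven q (.inr (.inr (.inl ()))) j =
      (colLabelEven j).α - (colLabelEven j).β := by
    rintro (_ | _ | k | k) hj
    · exact absurd rfl hj
    all_goals simp [entryEven, colLabelEven, ColLabel.β, ColLabel.α]
  have e3 : ∀ j, j ≠ .inl () → ∀ c, entryEven q (.inr (.inr (.inr c))) j =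
      (colLabelEven j).α * zetaTrace (q - 1) (param c * (colLabelEven j).a) := by
    rintro (_ | _ | k | k) hj c
    · exact absurd rfl hj
    all_goals simp [entryEven, colLabelEven, ColLabel.α, ColLabel.a, zetaTrace_zero, zetaSum_eq,
      mul_comm (param c : ℤ)]
  have h := sum_rows_eq (M := q - 1) (N := q + 1) q (by omega) (by omega) (colLabelEven x)
    (colLabelEven y) (colLabelEven z)
  rw [← sum_param_of_odd (m := (q - 2) / 2) (by omega), ← sum_param_of_odd (m := q / 2) (by omega)]
    at h
  have hσ : ∀ j, j ≠ .inl () → (colLabelEven (q := q) j).σ = 0 := by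
    rintro (_ | _ | k | k) hj <;> rfl
  simp only [schurForm, hσ x hx, hσ y hy, hσ z hz]
  push_cast
  simp only [zero_mul, mul_zero, add_zero]
  push_cast at h
  rw [← h]
  simp only [Fintype.sum_sum_type, Finset.univ_unique, Finset.sum_singleton, PUnit.default_eq_unit,
    e1 x hx, e1 y hy, e1 z hz, e2 x hx, e2 y hy, e2 z hz, e3 x hx, e3 y hy, e3 z hz]
  simp only [entryEven, div_eq_inv_mul]
  ring

noncomputable def verlindeTableEven (hq : 2 ≤ q) (h2 : q % 2 = 0) :
    VerlindeTable (entryEven q) (.inl ()) :=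
  .ofLabel (g := 1) (.inl rfl) rowLabelEven rowLabelEven_injective rowLabelEven_valid weightEven
    (by
      have h : (2 : ℝ) ≤ q := by exact_mod_cast hq
      have h' : 0 < q - 1 := by omega
      have h3 : (0 : ℝ) < q ^ 2 - 1 := by nlinarith
      rintro (_ | _ | k | k) <;> simp only [weightEven] <;> positivity)
    (.inl ()) rfl (fun _ => rfl) id (by rintro (_ | c | _ | c) <;> rfl)
    (fun i l => (star_entryEven i l).symm) id (fun i l => (star_entryEven i l).symm)
    (by simp; omega)
    (by
      have h : (2 : ℝ) ≤ q := by exact_mod_cast hq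
      have h1 : (0 : ℂ) < q - 1 := by
        have : (0 : ℝ) < q - 1 := by linarith
        exact_mod_cast Complex.zero_lt_real.mpr this
      have h2 : (0 : ℂ) < q := by exact_mod_cast Complex.zero_lt_real.mpr (by linarith : (0 : ℝ) < q)
      rintro (_ | c | _ | c) <;> simp only [entryEven]
      exacts [one_pos, h1, h2, add_pos h2 one_pos])
    (sum_weightEven hq h2)

end Even

/-! ### Preparations for odd `q` -/

theorem zetaSum_two_mul_mul {n n' : ℕ} (h : n = 2 * n') (k c : ℕ) :
    zetaSum n (2 * k * c) = zetaTrace n' (k * c) := by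
  rw [h, mul_assoc, zetaSum_two_mul]
  push_cast
  rfl

/-- The contribution of the two constituents of a reducible character. -/
theorem sum_reducible (ξ d a₁ a₂ a₃ s₁ s₂ s₃ : ℂ) :
    (a₁ - s₁ * ξ / 2) * (a₂ - s₂ * ξ / 2) * (a₃ - s₃ * ξ / 2) / (d / 2) +
      (a₁ + s₁ * ξ / 2) * (a₂ + s₂ * ξ / 2) * (a₃ + s₃ * ξ / 2) / (d / 2) =
    4 * (a₁ * a₂ * a₃) / d + ξ ^ 2 / d * (s₁ * s₂ * a₃ + s₁ * s₃ * a₂ + s₂ * s₃ * a₁) := by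
  simp only [div_eq_mul_inv, mul_inv, inv_inv]
  ring

theorem ofReal_sqrt_sq (q : ℕ) : (Real.sqrt q : ℂ) ^ 2 = q := by
  rw [← Complex.ofReal_pow, Real.sq_sqrt (Nat.cast_nonneg q), Complex.ofReal_natCast]

theorem I_mul_sqrt_sq (q : ℕ) : (Complex.I * (Real.sqrt q : ℂ)) ^ 2 = -q := by
  rw [mul_pow, Complex.I_sq, ofReal_sqrt_sq, neg_one_mul]

/-! ### The table for `q ≡ 3 mod 4`, where `D(N / 2)` splits -/

section Three

variable {q : ℕ}

def rowLabelThree : Unit ⊕ Fin 2 ⊕ Fin ((q - 3) / 4) ⊕ Unit ⊕ Fin ((q - 3) / 4) → RowLabel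
  | .inl _ => .one
  | .inr (.inl c) => .hd c
  | .inr (.inr (.inl c)) => .d (param c)
  | .inr (.inr (.inr (.inl _))) => .st
  | .inr (.inr (.inr (.inr c))) => .p (param c)

/-- The labels of the columns; the one of the first column has no meaning. -/
def colLabelThree : Unit ⊕ Fin 2 ⊕ Fin ((q - 3) / 4) ⊕ Fin ((q - 3) / 4) ⊕ Unit → ColLabel
  | .inl _ => .u 0
  | .inr (.inl k) => .u ((-1) ^ param k)
  | .inr (.inr (.inl k)) => .s (param k)
  | .inr (.inr (.inr (.inl k))) => .n (param k)
  | .inr (.inr (.inr (.inr _))) => .n ((q + 1) / 4)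

noncomputable def weightThree : Unit ⊕ Fin 2 ⊕ Fin ((q - 3) / 4) ⊕ Fin ((q - 3) / 4) ⊕ Unit → ℝ
  | .inl _ => 2 / (q * (q ^ 2 - 1))
  | .inr (.inl _) => 1 / q
  | .inr (.inr (.inl _)) => (((q - 1) / 2 : ℕ) : ℝ)⁻¹
  | .inr (.inr (.inr (.inl _))) => (((q + 1) / 2 : ℕ) : ℝ)⁻¹
  | .inr (.inr (.inr (.inr _))) => (((q + 1) / 2 : ℕ) : ℝ)⁻¹ / 2

theorem entryThree_first (i) : entryThree q i (.inl ()) =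
    (rowLabelThree i).α * (q + 1) + (rowLabelThree i).β * (q - 1) := by
  rcases i with _ | c | c | _ | c <;>
    simp [entryThree, rowLabelThree, RowLabel.α, RowLabel.β] <;> ring

theorem entryThree_unipotent (i k) : entryThree q i (.inr (.inl k)) =
    (rowLabelThree i).α - (rowLabelThree i).β + (rowLabelThree i).γ * ((-1) ^ param k * (Complex.I * (Real.sqrt q : ℂ))) := by
  rcases i with _ | c | c | _ | c <;>
    norm_num [entryThree, rowLabelThree, RowLabel.α, RowLabel.β, RowLabel.γ]
  ring

theorem entryThree_split (hq : q % 4 = 3) (i k) : entryThree q i (.inr (.inr (.inl k))) =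
    (rowLabelThree i).α *
      zetaTrace ((q - 1) / 2) (param k * (rowLabelThree i).a ((q - 1) / 2)) := by
  have hM : q - 1 = 2 * ((q - 1) / 2) := by omega
  rcases i with _ | c | c | _ | c <;>
    simp [-Int.natCast_ediv, entryThree, rowLabelThree, RowLabel.α, RowLabel.a, zetaTrace_zero,
      zetaSum_two_mul_mul hM]

theorem entryThree_nonsplit (hq : q % 4 = 3) (i k) :
    entryThree q i (.inr (.inr (.inr (.inl k)))) = -(rowLabelThree i).β *
      zetaTrace ((q + 1) / 2) (param k * (rowLabelThree i).b ((q + 1) / 2)) := by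
  have hN : q + 1 = 2 * ((q + 1) / 2) := by omega
  rcases i with _ | c | c | _ | c <;>
    simp [-Int.natCast_ediv, entryThree, rowLabelThree, RowLabel.β, RowLabel.b, zetaTrace_zero,
      zetaSum_two_mul_mul hN,
      zetaTrace_mul_half (show (q + 1) / 2 / 2 ≠ 0 by omega)
        (show (q + 1) / 2 = 2 * ((q + 1) / 2 / 2) by omega), pow_succ]

theorem entryThree_half (hq : q % 4 = 3) (i) : entryThree q i (.inr (.inr (.inr (.inr ())))) =
    -(rowLabelThree i).β *
      zetaTrace ((q + 1) / 2) (((q + 1) / 4 : ℕ) * (rowLabelThree i).b ((q + 1) / 2)) := by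
  have e1 : ∀ k : ℕ, zetaTrace ((q + 1) / 2) ((((q + 1) / 4 : ℕ) : ℤ) * k) = 2 * (-1) ^ k := by
    intro k
    rw [mul_comm, zetaTrace_mul_half (by omega) (by omega)]
  rcases i with _ | c | c | _ | c <;>
    simp only [entryThree, rowLabelThree, RowLabel.β, RowLabel.b, mul_zero, zetaTrace_zero, e1]
  · norm_num
  · rw [show (q + 1) / 2 / 2 = (q + 1) / 4 by omega]
    ring
  · ring
  · norm_num
  · ring

theorem rowLabelThree_injective : Function.Injective (rowLabelThree (q := q)) := by
  rintro (_ | c | c | _ | c) (_ | c' | c' | _ | c') h <;>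
    simp_all [rowLabelThree, param_injective.eq_iff]

theorem rowLabelThree_valid (hq : q % 4 = 3) (i) :
    (rowLabelThree (q := q) i).Valid 2 ((q - 1) / 2) ((q + 1) / 2) (-1) := by
  rcases i with _ | c | c | _ | c <;> simp only [rowLabelThree, RowLabel.Valid]
  · refine ⟨by simp, by simp, ?_, ?_⟩ <;> omega
  · have := param_le c
    have := param_pos c
    omega
  · have := param_le c
    have := param_pos c
    omega

theorem colLabelThree_valid (hq : q % 4 = 3) (j) (hj : j ≠ .inl ()) :
    (colLabelThree (q := q) j).Valid 2 ((q - 1) / 2) ((q + 1) / 2) := by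
  rcases j with _ | c | k | k | _ <;> simp only [colLabelThree, ColLabel.Valid]
  · exact absurd rfl hj
  · exact .inr ⟨trivial, neg_one_pow_eq_or ℤ _⟩
  · have := param_le k
    have := param_pos k
    omega
  · have := param_le k
    have := param_pos k
    omega
  · omega

theorem sum_weightThree (hq : q % 4 = 3) (x y z) :
    ∑ l, (weightThree l : ℂ) * (entryThree q x l * entryThree q y l * entryThree q z l) =
      tripleForm 2 ((q - 1) / 2) ((q + 1) / 2) (-1) (rowLabelThree x) (rowLabelThree y)
        (rowLabelThree z) := by
  have hM : (2 : ℂ) * ((q - 1) / 2 : ℕ) = q - 1 := by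
    rw [eq_sub_iff_add_eq]
    norm_cast
    omega
  have hN : (2 : ℂ) * ((q + 1) / 2 : ℕ) = q + 1 := by
    norm_cast
    omega
  rw [← sum_columns_eq_tripleForm (q := q) (ξ := Complex.I * (Real.sqrt q : ℂ)) (by omega) (by omega) two_ne_zero
    (by norm_cast; omega) (by exact_mod_cast hM) (by exact_mod_cast hN) (by simpa using I_mul_sqrt_sq q),
    ← sum_param_of_odd (m := (q - 3) / 4) (by omega), ← sum_param_of_even (m := (q - 3) / 4) (by omega),
    show (q - 3) / 4 + 1 = (q + 1) / 4 by omega]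
  simp only [Fintype.sum_sum_type, Finset.univ_unique, Finset.sum_singleton, PUnit.default_eq_unit,
    entryThree_first, entryThree_unipotent, entryThree_split hq, entryThree_nonsplit hq,
    entryThree_half hq, weightThree, Fin.sum_univ_two, param]
  push_cast
  norm_num
  ring

/-- This is the shape, mean value plus or minus `s * ξ / 2`, to which `sum_reducible` applies. -/
theorem entryThree_reducible (c j) (hj : j ≠ .inl ()) :
    entryThree q (.inr (.inl c)) j = -(colLabelThree j).β * (colLabelThree j).τ +
      (-1) ^ param c * (colLabelThree j).σ * (Complex.I * (Real.sqrt q : ℂ)) / 2 := by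
  rcases j with _ | k | k | k | k
  · exact absurd rfl hj
  all_goals simp [entryThree, colLabelThree, ColLabel.β, ColLabel.τ, ColLabel.σ]
  all_goals ring

theorem sum_entryThree (hq : q % 4 = 3) (x y z) (hx : x ≠ .inl ()) (hy : y ≠ .inl ())
    (hz : z ≠ .inl ()) :
    ∑ i, entryThree q i x * entryThree q i y * entryThree q i z / entryThree q i (.inl ()) =
      schurForm q ((q - 1) / 2) ((q + 1) / 2) (-1) (colLabelThree x) (colLabelThree y)
        (colLabelThree z) := by
  have hM : q - 1 = 2 * ((q - 1) / 2) := by omega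
  have hN : q + 1 = 2 * ((q + 1) / 2) := by omega
  have e : ∀ k : ℕ, zetaTrace ((q + 1) / 2) ((((q + 1) / 4 : ℕ) : ℤ) * k) = 2 * (-1) ^ k := by
    intro k
    rw [mul_comm, zetaTrace_mul_half (by omega) (by omega)]
  have e1 : ∀ j, j ≠ .inl () → ∀ c, entryThree q (.inr (.inr (.inl c))) j =
      -(colLabelThree j).β * zetaTrace ((q + 1) / 2) (param c * (colLabelThree j).b) := by
    rintro (_ | k | k | k | k) hj c
    · exact absurd rfl hj
    all_goals simp [-Int.natCast_ediv, e, entryThree, colLabelThree, ColLabel.β, ColLabel.b, zetaTrace_zero,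
      zetaSum_two_mul_mul hN, mul_comm (param c : ℤ)]
  have e2 : ∀ j, j ≠ .inl () → entryThree q (.inr (.inr (.inr (.inl ())))) j =
      (colLabelThree j).α - (colLabelThree j).β := by
    rintro (_ | k | k | k | k) hj
    · exact absurd rfl hj
    all_goals simp [entryThree, colLabelThree, ColLabel.β, ColLabel.α]
  have e3 : ∀ j, j ≠ .inl () → ∀ c, entryThree q (.inr (.inr (.inr (.inr c)))) j =
      (colLabelThree j).α * zetaTrace ((q - 1) / 2) (param c * (colLabelThree j).a) := by
    rintro (_ | k | k | k | k) hj c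
    · exact absurd rfl hj
    all_goals simp [-Int.natCast_ediv, entryThree, colLabelThree, ColLabel.α, ColLabel.a, zetaTrace_zero,
      zetaSum_two_mul_mul hM, mul_comm (param c : ℤ)]
  -- The half-weighted term at `c = N / 2` in `sum_rows_eq` belongs to the character that splits.
  -- Its factors are twice the mean values of the constituents, so it equals the term `4 * (a₁ * a₂
  -- * a₃) / d` of `sum_reducible`.
  have e4 : ∀ j : Unit ⊕ Fin 2 ⊕ Fin ((q - 3) / 4) ⊕ Fin ((q - 3) / 4) ⊕ Unit,
      -((colLabelThree j).β : ℂ) *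
        zetaTrace ((q + 1) / 2) ((((q + 1) / 4 : ℕ) : ℤ) * (colLabelThree j).b) =
      -(2 * (colLabelThree j).β * (colLabelThree j).τ) := by
    rintro (_ | k | k | k | k) <;>
      simp [-Int.natCast_ediv, colLabelThree, ColLabel.β, ColLabel.b, ColLabel.τ, zetaTrace_zero, e]
  have hξ : (Complex.I * (Real.sqrt q : ℂ)) ^ 2 = -q := I_mul_sqrt_sq q
  have h := sum_rows_eq (M := (q - 1) / 2) (N := (q + 1) / 2) q (by omega) (by omega)
    (colLabelThree x) (colLabelThree y) (colLabelThree z)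
  rw [← sum_param_of_odd (m := (q - 3) / 4) (by omega), ← sum_param_of_even (m := (q - 3) / 4) (by omega),
    show (q - 3) / 4 + 1 = (q + 1) / 4 by omega] at h
  simp only [Fintype.sum_sum_type, Finset.univ_unique, Finset.sum_singleton, PUnit.default_eq_unit,
    e1 x hx, e1 y hy, e1 z hz, e2 x hx, e2 y hy, e2 z hz, e3 x hx, e3 y hy, e3 z hz,
    Fin.sum_univ_two, entryThree_reducible _ _ hx, entryThree_reducible _ _ hy,
    entryThree_reducible _ _ hz]
  simp only [e4] at h
  have h' := sum_reducible (Complex.I * (Real.sqrt q : ℂ)) ((q : ℂ) - 1) (-((colLabelThree x).β * (colLabelThree x).τ))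
    (-((colLabelThree y).β * (colLabelThree y).τ)) (-((colLabelThree z).β * (colLabelThree z).τ))
    (colLabelThree x).σ (colLabelThree y).σ (colLabelThree z).σ
  rw [hξ] at h'
  have s0 : ((-1 : ℂ)) ^ param (0 : Fin 2) = -1 := by norm_num [param]
  have s1 : ((-1 : ℂ)) ^ param (1 : Fin 2) = 1 := by norm_num [param]
  simp only [schurForm, if_neg (by decide : ¬ (-1 : ℤ) = 1), s0, s1, entryThree]
  push_cast
  simp only [div_eq_inv_mul] at h h' ⊢
  linear_combination h + h'

def rowDualThree : Unit ⊕ Fin 2 ⊕ Fin ((q - 3) / 4) ⊕ Unit ⊕ Fin ((q - 3) / 4) → Unit ⊕ Fin 2 ⊕ Fin ((q - 3) / 4) ⊕ Unit ⊕ Fin ((q - 3) / 4)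
  | .inr (.inl c) => .inr (.inl c.rev)
  | x => x

def colDualThree : Unit ⊕ Fin 2 ⊕ Fin ((q - 3) / 4) ⊕ Fin ((q - 3) / 4) ⊕ Unit → Unit ⊕ Fin 2 ⊕ Fin ((q - 3) / 4) ⊕ Fin ((q - 3) / 4) ⊕ Unit
  | .inr (.inl k) => .inr (.inl k.rev)
  | x => x

theorem entryThree_rowDual (i j) : entryThree q (rowDualThree i) j = star (entryThree q i j) := by
  rcases i with _ | c | c | _ | c <;> rcases j with _ | k | k | k | k
  case inr.inl.inr.inl =>
    fin_cases c <;> fin_cases k <;> simp [entryThree, rowDualThree, param, Fin.rev] <;> ring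
  all_goals simp [entryThree, rowDualThree, ← starRingEnd_apply, Complex.conj_ofNat]
  all_goals simp [starRingEnd_apply, star_zetaSum]

/-- The sign of the imaginary part is `(-1) ^ (k + c)`, so exchanging the two unipotent columns has
the same effect as exchanging the two rows. -/
theorem entryThree_colDual (i j) : entryThree q i (colDualThree j) = star (entryThree q i j) := by
  rw [← entryThree_rowDual]
  rcases i with _ | c | c | _ | c <;> rcases j with _ | k | k | k | k
  case inr.inl.inr.inl =>
    fin_cases c <;> fin_cases k <;>
      norm_num [entryThree, rowDualThree, colDualThree, param, Fin.rev]
  all_goals rfl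

theorem weightThree_pos (hq : q % 4 = 3) (l) : 0 < weightThree (q := q) l := by
  have hq2 : (2 : ℝ) ≤ q := Nat.ofNat_le_cast.mpr (by omega)
  have hM : 0 < (q - 1) / 2 := by omega
  have hN : 0 < (q + 1) / 2 := by omega
  have h3 : (0 : ℝ) < q ^ 2 - 1 := by nlinarith
  rcases l with _ | k | k | k | k <;> simp only [weightThree] <;> positivity

theorem entryThree_first_pos (hq : 2 ≤ q) (i) : 0 < entryThree q i (.inl ()) := by
  have h : (2 : ℝ) ≤ q := by exact_mod_cast hq
  have h0 : (0 : ℝ) < q := by linarith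
  have h1 : (0 : ℝ) < q - 1 := by linarith
  have h2 : (0 : ℝ) < q - 1 := by linarith
  rcases i with _ | c | c | _ | c <;> simp only [entryThree]
  · exact one_pos
  · simpa using Complex.zero_lt_real.mpr (half_pos h2)
  · exact_mod_cast Complex.zero_lt_real.mpr h1
  · exact_mod_cast Complex.zero_lt_real.mpr h0
  · exact_mod_cast Complex.zero_lt_real.mpr (add_pos h0 one_pos)

noncomputable def verlindeTableThree (hq : q % 4 = 3) : VerlindeTable (entryThree q) (.inl ()) :=
  .ofLabel (g := 2) (.inr rfl) rowLabelThree rowLabelThree_injective (rowLabelThree_valid hq)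
    weightThree (weightThree_pos hq) (.inl ()) rfl (fun _ => rfl)
    rowDualThree (by rintro (_ | c | c | _ | c) <;> rfl) entryThree_rowDual
    colDualThree entryThree_colDual (by simp; omega)
    (entryThree_first_pos (by omega)) (sum_weightThree hq)

end Three

/-! ### The table for `q ≡ 1 mod 4`, where `P(M / 2)` splits -/

section One

variable {q : ℕ}

def rowLabelOne : Unit ⊕ Fin 2 ⊕ Fin ((q - 1) / 4) ⊕ Unit ⊕ Fin ((q - 5) / 4) → RowLabel
  | .inl _ => .one
  | .inr (.inl c) => .hp c
  | .inr (.inr (.inl c)) => .d (param c)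
  | .inr (.inr (.inr (.inl _))) => .st
  | .inr (.inr (.inr (.inr c))) => .p (param c)

/-- The labels of the columns; the one of the first column has no meaning. -/
def colLabelOne : Unit ⊕ Fin 2 ⊕ Fin ((q - 5) / 4) ⊕ Unit ⊕ Fin ((q - 1) / 4) → ColLabel
  | .inl _ => .u 0
  | .inr (.inl k) => .u ((-1) ^ param k)
  | .inr (.inr (.inl k)) => .s (param k)
  | .inr (.inr (.inr (.inr k))) => .n (param k)
  | .inr (.inr (.inr (.inl _))) => .s ((q - 1) / 4)

noncomputable def weightOne : Unit ⊕ Fin 2 ⊕ Fin ((q - 5) / 4) ⊕ Unit ⊕ Fin ((q - 1) / 4) → ℝ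
  | .inl _ => 2 / (q * (q ^ 2 - 1))
  | .inr (.inl _) => 1 / q
  | .inr (.inr (.inl _)) => (((q - 1) / 2 : ℕ) : ℝ)⁻¹
  | .inr (.inr (.inr (.inr _))) => (((q + 1) / 2 : ℕ) : ℝ)⁻¹
  | .inr (.inr (.inr (.inl _))) => (((q - 1) / 2 : ℕ) : ℝ)⁻¹ / 2

theorem entryOne_first (i) : entryOne q i (.inl ()) =
    (rowLabelOne i).α * (q + 1) + (rowLabelOne i).β * (q - 1) := by
  rcases i with _ | c | c | _ | c <;>
    simp [entryOne, rowLabelOne, RowLabel.α, RowLabel.β] <;> ring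

theorem entryOne_unipotent (i k) : entryOne q i (.inr (.inl k)) =
    (rowLabelOne i).α - (rowLabelOne i).β + (rowLabelOne i).γ * ((-1) ^ param k * ((Real.sqrt q : ℂ))) := by
  rcases i with _ | c | c | _ | c <;>
    norm_num [entryOne, rowLabelOne, RowLabel.α, RowLabel.β, RowLabel.γ]
  ring

theorem entryOne_split (hq : q % 4 = 1) (i k) : entryOne q i (.inr (.inr (.inl k))) =
    (rowLabelOne i).α *
      zetaTrace ((q - 1) / 2) (param k * (rowLabelOne i).a ((q - 1) / 2)) := by
  have hM : q - 1 = 2 * ((q - 1) / 2) := by omega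
  -- The degenerate case `q = 1` is excluded by the existence of the column `k`.
  have hr : (q - 1) / 2 / 2 ≠ 0 := by
    have := param_pos k
    have := param_le k
    omega
  rcases i with _ | c | c | _ | c <;>
    simp [-Int.natCast_ediv, entryOne, rowLabelOne, RowLabel.α, RowLabel.a, zetaTrace_zero,
      zetaSum_two_mul_mul hM,
      zetaTrace_mul_half hr
        (show (q - 1) / 2 = 2 * ((q - 1) / 2 / 2) by omega)]

theorem entryOne_nonsplit (hq : q % 4 = 1) (i k) :
    entryOne q i (.inr (.inr (.inr (.inr k)))) = -(rowLabelOne i).β *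
      zetaTrace ((q + 1) / 2) (param k * (rowLabelOne i).b ((q + 1) / 2)) := by
  have hN : q + 1 = 2 * ((q + 1) / 2) := by omega
  rcases i with _ | c | c | _ | c <;>
    simp [-Int.natCast_ediv, entryOne, rowLabelOne, RowLabel.β, RowLabel.b, zetaTrace_zero,
      zetaSum_two_mul_mul hN]

theorem entryOne_half (hq : q % 4 = 1) (h2 : 2 ≤ q) (i) : entryOne q i (.inr (.inr (.inr (.inl ())))) =
    (rowLabelOne i).α *
      zetaTrace ((q - 1) / 2) (((q - 1) / 4 : ℕ) * (rowLabelOne i).a ((q - 1) / 2)) := by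
  have e1 : ∀ k : ℕ, zetaTrace ((q - 1) / 2) ((((q - 1) / 4 : ℕ) : ℤ) * k) = 2 * (-1) ^ k := by
    intro k
    rw [mul_comm, zetaTrace_mul_half (by omega) (by omega)]
  rcases i with _ | c | c | _ | c <;>
    simp only [entryOne, rowLabelOne, RowLabel.α, RowLabel.a, mul_zero, zetaTrace_zero, e1]
  · norm_num
  · rw [show (q - 1) / 2 / 2 = (q - 1) / 4 by omega]
    ring
  · ring
  · norm_num
  · ring

theorem rowLabelOne_injective : Function.Injective (rowLabelOne (q := q)) := by
  rintro (_ | c | c | _ | c) (_ | c' | c' | _ | c') h <;>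
    simp_all [rowLabelOne, param_injective.eq_iff]

theorem rowLabelOne_valid (hq : q % 4 = 1) (h2 : 2 ≤ q) (i) :
    (rowLabelOne (q := q) i).Valid 2 ((q - 1) / 2) ((q + 1) / 2) (1) := by
  rcases i with _ | c | c | _ | c <;> simp only [rowLabelOne, RowLabel.Valid]
  · refine ⟨by simp, by simp, ?_, ?_⟩ <;> omega
  · have := param_le c
    have := param_pos c
    omega
  · have := param_le c
    have := param_pos c
    omega

theorem colLabelOne_valid (hq : q % 4 = 1) (h2 : 2 ≤ q) (j) (hj : j ≠ .inl ()) :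
    (colLabelOne (q := q) j).Valid 2 ((q - 1) / 2) ((q + 1) / 2) := by
  rcases j with _ | c | k | _ | k <;> simp only [colLabelOne, ColLabel.Valid]
  · exact absurd rfl hj
  · exact .inr ⟨trivial, neg_one_pow_eq_or ℤ _⟩
  · have := param_le k
    have := param_pos k
    omega
  · omega
  · have := param_le k
    have := param_pos k
    omega

theorem sum_weightOne (hq : q % 4 = 1) (h2 : 2 ≤ q) (x y z) :
    ∑ l, (weightOne l : ℂ) * (entryOne q x l * entryOne q y l * entryOne q z l) =
      tripleForm 2 ((q - 1) / 2) ((q + 1) / 2) (1) (rowLabelOne x) (rowLabelOne y)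
        (rowLabelOne z) := by
  have hM : (2 : ℂ) * ((q - 1) / 2 : ℕ) = q - 1 := by
    rw [eq_sub_iff_add_eq]
    norm_cast
    omega
  have hN : (2 : ℂ) * ((q + 1) / 2 : ℕ) = q + 1 := by
    norm_cast
    omega
  rw [← sum_columns_eq_tripleForm (q := q) (ξ := (Real.sqrt q : ℂ)) (by omega) (by omega) two_ne_zero
    (by norm_cast; omega) (by exact_mod_cast hM) (by exact_mod_cast hN) (by simpa using ofReal_sqrt_sq q),
    ← sum_param_of_even (m := (q - 5) / 4) (by omega), ← sum_param_of_odd (m := (q - 1) / 4) (by omega),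
    show (q - 5) / 4 + 1 = (q - 1) / 4 by omega]
  simp only [Fintype.sum_sum_type, Finset.univ_unique, Finset.sum_singleton, PUnit.default_eq_unit,
    entryOne_first, entryOne_unipotent, entryOne_split hq, entryOne_nonsplit hq,
    entryOne_half hq h2, weightOne, Fin.sum_univ_two, param]
  push_cast
  norm_num
  ring

theorem entryOne_reducible (c j) (hj : j ≠ .inl ()) :
    entryOne q (.inr (.inl c)) j = (colLabelOne j).α * (colLabelOne j).τ +
      (-1) ^ param c * (colLabelOne j).σ * ((Real.sqrt q : ℂ)) / 2 := by
  rcases j with _ | k | k | k | k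
  · exact absurd rfl hj
  all_goals simp [entryOne, colLabelOne, ColLabel.α, ColLabel.τ, ColLabel.σ]
  ring

theorem sum_entryOne (hq : q % 4 = 1) (h2 : 2 ≤ q) (x y z) (hx : x ≠ .inl ()) (hy : y ≠ .inl ())
    (hz : z ≠ .inl ()) :
    ∑ i, entryOne q i x * entryOne q i y * entryOne q i z / entryOne q i (.inl ()) =
      schurForm q ((q - 1) / 2) ((q + 1) / 2) (1) (colLabelOne x) (colLabelOne y)
        (colLabelOne z) := by
  have hM : q - 1 = 2 * ((q - 1) / 2) := by omega
  have hN : q + 1 = 2 * ((q + 1) / 2) := by omega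
  have e : ∀ k : ℕ, zetaTrace ((q - 1) / 2) ((((q - 1) / 4 : ℕ) : ℤ) * k) = 2 * (-1) ^ k := by
    intro k
    rw [mul_comm, zetaTrace_mul_half (by omega) (by omega)]
  have e1 : ∀ j, j ≠ .inl () → ∀ c, entryOne q (.inr (.inr (.inl c))) j =
      -(colLabelOne j).β * zetaTrace ((q + 1) / 2) (param c * (colLabelOne j).b) := by
    rintro (_ | k | k | k | k) hj c
    · exact absurd rfl hj
    all_goals simp [-Int.natCast_ediv, entryOne, colLabelOne, ColLabel.β, ColLabel.b, zetaTrace_zero,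
      zetaSum_two_mul_mul hN, mul_comm (param c : ℤ)]
  have e2 : ∀ j, j ≠ .inl () → entryOne q (.inr (.inr (.inr (.inl ())))) j =
      (colLabelOne j).α - (colLabelOne j).β := by
    rintro (_ | k | k | k | k) hj
    · exact absurd rfl hj
    all_goals simp [entryOne, colLabelOne, ColLabel.β, ColLabel.α]
  have e3 : ∀ j, j ≠ .inl () → ∀ c, entryOne q (.inr (.inr (.inr (.inr c)))) j =
      (colLabelOne j).α * zetaTrace ((q - 1) / 2) (param c * (colLabelOne j).a) := by
    rintro (_ | k | k | k | k) hj c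
    · exact absurd rfl hj
    all_goals simp [-Int.natCast_ediv, e, entryOne, colLabelOne, ColLabel.α, ColLabel.a, zetaTrace_zero,
      zetaSum_two_mul_mul hM, mul_comm (param c : ℤ)]
  -- Here the half-weighted term is the one at `c = M / 2`, and it is matched with the two
  -- constituents of the principal series.
  have e4 : ∀ j : Unit ⊕ Fin 2 ⊕ Fin ((q - 5) / 4) ⊕ Unit ⊕ Fin ((q - 1) / 4),
      ((colLabelOne j).α : ℂ) *
        zetaTrace ((q - 1) / 2) ((((q - 1) / 4 : ℕ) : ℤ) * (colLabelOne j).a) =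
      (2 * (colLabelOne j).α * (colLabelOne j).τ) := by
    rintro (_ | k | k | k | k) <;>
      simp [-Int.natCast_ediv, colLabelOne, ColLabel.α, ColLabel.a, ColLabel.τ, zetaTrace_zero, e]
  have hξ : (Real.sqrt q : ℂ) ^ 2 = q := ofReal_sqrt_sq q
  have h := sum_rows_eq (M := (q - 1) / 2) (N := (q + 1) / 2) q (by omega) (by omega)
    (colLabelOne x) (colLabelOne y) (colLabelOne z)
  rw [← sum_param_of_even (m := (q - 5) / 4) (by omega), ← sum_param_of_odd (m := (q - 1) / 4) (by omega),
    show (q - 5) / 4 + 1 = (q - 1) / 4 by omega] at h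
  simp only [Fintype.sum_sum_type, Finset.univ_unique, Finset.sum_singleton, PUnit.default_eq_unit,
    e1 x hx, e1 y hy, e1 z hz, e2 x hx, e2 y hy, e2 z hz, e3 x hx, e3 y hy, e3 z hz,
    Fin.sum_univ_two, entryOne_reducible _ _ hx, entryOne_reducible _ _ hy,
    entryOne_reducible _ _ hz]
  simp only [e4] at h
  have h' := sum_reducible ((Real.sqrt q : ℂ)) ((q : ℂ) + 1) (((colLabelOne x).α * (colLabelOne x).τ))
    (((colLabelOne y).α * (colLabelOne y).τ)) (((colLabelOne z).α * (colLabelOne z).τ))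
    (colLabelOne x).σ (colLabelOne y).σ (colLabelOne z).σ
  rw [hξ] at h'
  have s0 : ((-1 : ℂ)) ^ param (0 : Fin 2) = -1 := by norm_num [param]
  have s1 : ((-1 : ℂ)) ^ param (1 : Fin 2) = 1 := by norm_num [param]
  simp only [schurForm, if_true, s0, s1, entryOne]
  push_cast
  simp only [div_eq_inv_mul] at h h' ⊢
  linear_combination h + h'

theorem star_entryOne (i j) : star (entryOne q i j) = entryOne q i j := by
  rcases i with _ | c | c | _ | c <;> rcases j with _ | k | k | k | k <;>
    simp [entryOne, ← starRingEnd_apply, Complex.conj_ofNat]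
  all_goals simp [starRingEnd_apply, star_zetaSum]

theorem weightOne_pos (hq : q % 4 = 1) (h2 : 2 ≤ q) (l) : 0 < weightOne (q := q) l := by
  have hq2 : (2 : ℝ) ≤ q := Nat.ofNat_le_cast.mpr (by omega)
  have hM : 0 < (q - 1) / 2 := by omega
  have hN : 0 < (q + 1) / 2 := by omega
  have h3 : (0 : ℝ) < q ^ 2 - 1 := by nlinarith
  rcases l with _ | k | k | k | k <;> simp only [weightOne] <;> positivity

theorem entryOne_first_pos (hq : 2 ≤ q) (i) : 0 < entryOne q i (.inl ()) := by
  have h : (2 : ℝ) ≤ q := by exact_mod_cast hq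
  have h0 : (0 : ℝ) < q := by linarith
  have h1 : (0 : ℝ) < q - 1 := by linarith
  have h2 : (0 : ℝ) < q + 1 := by linarith
  rcases i with _ | c | c | _ | c <;> simp only [entryOne]
  · exact one_pos
  · simpa using Complex.zero_lt_real.mpr (half_pos h2)
  · exact_mod_cast Complex.zero_lt_real.mpr h1
  · exact_mod_cast Complex.zero_lt_real.mpr h0
  · exact_mod_cast Complex.zero_lt_real.mpr (add_pos h0 one_pos)

noncomputable def verlindeTableOne (hq : q % 4 = 1) (h2 : 2 ≤ q) : VerlindeTable (entryOne q) (.inl ()) :=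
  .ofLabel (g := 2) (.inr rfl) rowLabelOne rowLabelOne_injective (rowLabelOne_valid hq h2)
    weightOne (weightOne_pos hq h2) (.inl ()) rfl (fun _ => rfl)
    id (by rintro (_ | c | c | _ | c) <;> rfl) (fun i l => (star_entryOne i l).symm)
    id (fun i l => (star_entryOne i l).symm) (by simp; omega)
    (entryOne_first_pos h2) (sum_weightOne hq h2)

end One

/-! ### Assembly of the three cases -/

/-- The claims about the table `T`. -/
def FormalTable.HasSchurFusionRing (T : FormalTable) : Prop :=
  (∃! R : FusionRing T.Row, R.IsEigentable T.entry) ∧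
  IsMaxColumn T.entry T.firstCol ∧
  (∀ j₁ j₂ j₃ : T.Col,
    (0 : ℂ) ≤ ∑ i, T.entry i j₁ * T.entry i j₂ * T.entry i j₃ / T.entry i T.firstCol) ∧
  (∀ R : FusionRing T.Row, R.IsEigentable T.entry → R.PassesSchurProductCriterion)

theorem hasSchurFusionRing_tableEven {q : ℕ} (hq : 2 ≤ q) (h2 : q % 2 = 0) :
    (tableEven q).HasSchurFusionRing := by
  refine (verlindeTableEven hq h2).conclusions fun x y z hx hy hz => ?_
  rw [sum_entryEven hq h2 x y z hx hy hz]
  refine Complex.zero_le_real.mpr (schurForm_nonneg (g := 1) ?_ ?_ ?_ (.inl rfl) ?_ ?_ ?_ _ _ _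
    (colLabelEven_valid _) (colLabelEven_valid _) (colLabelEven_valid _))
  · exact Nat.cast_pos.mpr (by omega)
  · omega
  · omega
  · exact fun _ => by rw [Nat.odd_iff]; omega
  · rw [Nat.cast_sub (by omega)]
    simp
  · simp

theorem hasSchurFusionRing_tableThree {q : ℕ} (hq : q % 4 = 3) :
    (tableThree q).HasSchurFusionRing := by
  refine (verlindeTableThree hq).conclusions fun x y z hx hy hz => ?_
  rw [sum_entryThree hq x y z hx hy hz]
  refine Complex.zero_le_real.mpr (schurForm_nonneg (g := 2) ?_ ?_ ?_ (.inr rfl) ?_ ?_ ?_ _ _ _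
    (colLabelThree_valid hq _ hx) (colLabelThree_valid hq _ hy) (colLabelThree_valid hq _ hz))
  · exact Nat.cast_pos.mpr (by omega)
  · omega
  · omega
  · simp
  · rw [eq_sub_iff_add_eq]
    norm_cast
    omega
  · norm_cast
    omega

theorem hasSchurFusionRing_tableOne {q : ℕ} (hq : q % 4 = 1) (h2 : 2 ≤ q) :
    (tableOne q).HasSchurFusionRing := by
  refine (verlindeTableOne hq h2).conclusions fun x y z hx hy hz => ?_
  rw [sum_entryOne hq h2 x y z hx hy hz]
  refine Complex.zero_le_real.mpr (schurForm_nonneg (g := 2) ?_ ?_ ?_ (.inr rfl) ?_ ?_ ?_ _ _ _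
    (colLabelOne_valid hq h2 _ hx) (colLabelOne_valid hq h2 _ hy) (colLabelOne_valid hq h2 _ hz))
  · exact Nat.cast_pos.mpr (by omega)
  · omega
  · omega
  · simp
  · rw [eq_sub_iff_add_eq]
    norm_cast
    omega
  · norm_cast
    omega

theorem hasSchurFusionRing_genericTable {q : ℕ} (hq : 2 ≤ q) :
    (genericTable q).HasSchurFusionRing := by
  rw [genericTable]
  split_ifs with h h'
  · exact hasSchurFusionRing_tableEven hq h
  · exact hasSchurFusionRing_tableThree h'
  · exact hasSchurFusionRing_tableOne (by omega) hq

theorem mainTheorem10 (q : ℕ) (hq : 2 ≤ q) :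
    (∃! R : FusionRing (genericTable q).Row, IsInterpolatedFusionRing q R) ∧
    IsMaxColumn (genericTable q).entry (genericTable q).firstCol ∧
    (∀ j₁ j₂ j₃ : (genericTable q).Col,
      (0 : ℂ) ≤ ∑ i, (genericTable q).entry i j₁ * (genericTable q).entry i j₂ *
        (genericTable q).entry i j₃ / (genericTable q).entry i (genericTable q).firstCol) ∧
    (∀ R : FusionRing (genericTable q).Row, IsInterpolatedFusionRing q R →
      R.PassesSchurProductCriterion) :=
  hasSchurFusionRing_genericTable hq
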